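/- Let $\mathbb K\in\{\mathbb R,\mathbb C\}$; all spaces are over $\mathbb K$. A \emph{Banach duality} $\langle X,Y\rangle$ between Banach spaces $X,Y$ is a bounded bilinear form $X\times Y\to\mathbb K$ for which the induced maps $X\to Y^*$ and $Y\to X^*$ are injective; $\sigma(X,Y)$ denotes the weak topology on $X$ generated by the pairing. A \emph{Banach function space} on a measure space $(B,\nu)$ is an ideal of $L^0(B)$ with a complete lattice norm. A \emph{Köthe dual pair} $\langle F,G\rangle$ on $B$ is a Banach duality between Banach function spaces $F,G$ on $B$ with $F\cdot G\subset L^1(B)$ and pairing $\langle f,g\rangle=\int_B fg\,d\nu$. For a Banach function space $E$ on $B$ and a Banach space $X$, $E(X)$ is the space of (classes of) strongly measurable $f:B\to X$ with $\|f(\cdot)\|_X\in E$, normed by $\big\|\,\|f(\cdot)\|_X\big\|_E$, and $E\tilde\otimes X$ is the closure in $E(X)$ of $E\otimes X$, the linear span of the functions $e\otimes x: b\mapsto e(b)x$. The spaces $L^\infty(A;Y)$ and $L^1(A;X)$, and likewise $G(Y)$ and $F\tilde\otimes X$, are paired by $\int\langle\cdot,\cdot\rangle_{\langle X,Y\rangle}$.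 A linear operator between Banach lattices is \emph{regular} if it is a linear combination of positive operators. A Banach lattice has a \emph{Levi norm} if every increasing norm bounded net of positive elements has a supremum. \textbf{Proposition.} Let $(A,\mathscr A,\mu)$ be a semi-finite measure space, let $\langle F,G\rangle$ be a Köthe dual pair of Banach function spaces over a measure space $(B,\mathscr B,\nu)$, and let $T\in\mathcal L(L^\infty(A),G)$ be a $\sigma(L^\infty(A),L^1(A))$-to-$\sigma(G,F)$ continuous linear operator. Suppose that either (i) $G$ has a Levi norm, or (ii) the image of the map $g\mapsto\langle\,\cdot\,,g\rangle$, $G\to F^*$, is a band in $F^*$. Then $T$ is regular if, for some Banach duality $\langle X,Y\rangle$ between Banach spaces, with $Y=\ell^1$ in case (i) and $X=\ell^1$ in case (ii), the operator $T\otimes I_Y: L^\infty(A)\otimes Y\to G\otimes Y$ has an extension to a bounded linear operator $T_Y\in\mathcal L(L^\infty(A;Y),G(Y))$ that is $\sigma(L^\infty(A;Y),L^1(A;X))$-to-$\sigma(G(Y),F\tilde\otimes X)$ continuous. -/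

import Mathlib

open MeasureTheory Filter Topology
open scoped ENNReal ComplexOrder

noncomputable section

/-- A measure is semi-finite if every measurable set of positive measure contains a measurable
set of positive and finite measure. -/
def IsSemifinite {A : Type*} [MeasurableSpace A] (μ : Measure A) : Prop :=
  ∀ s : Set A, MeasurableSet s → 0 < μ s → ∃ t ⊆ s, MeasurableSet t ∧ 0 < μ t ∧ μ t < ∞

/-- A Banach function space over `𝕜` on a measure space: an ideal of `L⁰` (the space of a.e.
classes of measurable `𝕜`-valued functions) with a complete lattice norm. -/
structure BanachFunctionSpace (𝕜 : Type*) [RCLike 𝕜] {B : Type*} [MeasurableSpace B]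
    (ν : Measure B) where
  carrier : Submodule 𝕜 (B →ₘ[ν] 𝕜)
  ideal' : ∀ f : B →ₘ[ν] 𝕜, ∀ g ∈ carrier, (∀ᵐ b ∂ν, ‖f b‖ ≤ ‖g b‖) → f ∈ carrier
  nrm : Seminorm 𝕜 carrier
  eq_zero_of_nrm' : ∀ f : carrier, nrm f = 0 → f = 0
  nrm_mono' : ∀ f g : carrier,
    (∀ᵐ b ∂ν, ‖(f : B →ₘ[ν] 𝕜) b‖ ≤ ‖(g : B →ₘ[ν] 𝕜) b‖) → nrm f ≤ nrm g
  complete' : ∀ u : ℕ → carrier,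
    (∀ ε : ℝ, 0 < ε → ∃ N : ℕ, ∀ m ≥ N, ∀ n ≥ N, nrm (u m - u n) < ε) →
      ∃ f : carrier, Tendsto (fun n => nrm (u n - f)) atTop (𝓝 0)

section AEClasses

variable {B : Type*} [MeasurableSpace B] {ν : Measure B} {X : Type*} [NormedAddCommGroup X]

/-- The class of `b ↦ ‖f b‖`, regarded as a `𝕜`-valued function. -/
def aeNorm (𝕜 : Type*) [RCLike 𝕜] (f : B →ₘ[ν] X) : B →ₘ[ν] 𝕜 :=
  f.comp (fun x => ((‖x‖ : ℝ) : 𝕜)) (by fun_prop)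

theorem aeNorm_norm (𝕜 : Type*) [RCLike 𝕜] (f : B →ₘ[ν] X) :
    ∀ᵐ b ∂ν, ‖aeNorm 𝕜 f b‖ = ‖f b‖ := by
  filter_upwards [AEEqFun.coeFn_comp (fun x : X => ((‖x‖ : ℝ) : 𝕜)) (by fun_prop) f] with b hb
  simp [aeNorm, hb]

/-- The elementary tensor `f ⊗ x`, that is, the class of `b ↦ f b • x`. -/
def aeTensor {𝕜 : Type*} [RCLike 𝕜] [NormedSpace 𝕜 X] (f : B →ₘ[ν] 𝕜) (x : X) : B →ₘ[ν] X :=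
  f.comp (fun c => c • x) (by fun_prop)

theorem aeTensor_coe {𝕜 : Type*} [RCLike 𝕜] [NormedSpace 𝕜 X] (f : B →ₘ[ν] 𝕜) (x : X) :
    ∀ᵐ b ∂ν, aeTensor f x b = f b • x :=
  AEEqFun.coeFn_comp (fun c : 𝕜 => c • x) (by fun_prop) f

end AEClasses

namespace BanachFunctionSpace

variable {𝕜 : Type*} [RCLike 𝕜] {B : Type*} [MeasurableSpace B] {ν : Measure B}

instance : CoeSort (BanachFunctionSpace 𝕜 ν) (Type _) := ⟨fun E => E.carrier⟩

instance instNormedAddCommGroup (E : BanachFunctionSpace 𝕜 ν) : NormedAddCommGroup E.carrier :=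
  AddGroupNorm.toNormedAddCommGroup
    { toFun := E.nrm
      map_zero' := map_zero E.nrm
      add_le' := map_add_le_add E.nrm
      neg' := map_neg_eq_map E.nrm
      eq_zero_of_map_eq_zero' := fun f hf => E.eq_zero_of_nrm' f hf }

instance instNormedSpace (E : BanachFunctionSpace 𝕜 ν) : NormedSpace 𝕜 E.carrier where
  norm_smul_le c f := (map_smul_eq_mul E.nrm c f).le

/-- A Levi norm: every upward directed norm bounded family of positive elements (equivalently,
every increasing norm bounded net of positive elements) has a supremum. -/
def HasLeviNorm (E : BanachFunctionSpace 𝕜 ν) : Prop :=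
  ∀ D : Set E, D.Nonempty → (∀ d ∈ D, 0 ≤ d) → DirectedOn (· ≤ ·) D →
    (∃ C : ℝ, ∀ d ∈ D, ‖d‖ ≤ C) → ∃ s : E, IsLUB D s

variable (E : BanachFunctionSpace 𝕜 ν) (X : Type*) [NormedAddCommGroup X] [NormedSpace 𝕜 X]

/-- The Köthe-Bochner space `E(X)` of all (classes of) strongly measurable `f` with
`‖f(·)‖ ∈ E`. -/
def bochner : Submodule 𝕜 (B →ₘ[ν] X) where
  carrier := {f | aeNorm 𝕜 f ∈ E.carrier}
  zero_mem' := by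
    refine E.ideal' _ 0 E.carrier.zero_mem ?_
    filter_upwards [aeNorm_norm 𝕜 (0 : B →ₘ[ν] X), AEEqFun.coeFn_zero (α := B) (μ := ν) (β := X)]
      with b h1 h2
    rw [h1, h2]; simp
  add_mem' := by
    intro f g hf hg
    refine E.ideal' _ _ (E.carrier.add_mem hf hg) ?_
    filter_upwards [aeNorm_norm 𝕜 (f + g), AEEqFun.coeFn_add f g,
      AEEqFun.coeFn_add (aeNorm 𝕜 f) (aeNorm 𝕜 g),
      AEEqFun.coeFn_comp (fun x : X => ((‖x‖ : ℝ) : 𝕜)) (by fun_prop) f,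
      AEEqFun.coeFn_comp (fun x : X => ((‖x‖ : ℝ) : 𝕜)) (by fun_prop) g] with b h1 h2 h3 h4 h5
    have h6 : (aeNorm 𝕜 f + aeNorm 𝕜 g) b = ((‖f b‖ + ‖g b‖ : ℝ) : 𝕜) := by
      rw [h3]
      simp only [Pi.add_apply, aeNorm, h4, h5, Function.comp]
      push_cast; rfl
    rw [h1, h2, h6, RCLike.norm_ofReal, abs_of_nonneg (by positivity)]
    exact norm_add_le _ _
  smul_mem' := by
    intro c f hf
    refine E.ideal' _ _ (E.carrier.smul_mem c hf) ?_
    filter_upwards [aeNorm_norm 𝕜 (c • f), aeNorm_norm 𝕜 f, AEEqFun.coeFn_smul c f,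
      AEEqFun.coeFn_smul c (aeNorm 𝕜 f)] with b h1 h2 h3 h4
    rw [h1, h3, h4, Pi.smul_apply, Pi.smul_apply, norm_smul, norm_smul, h2]

variable {X}

/-- The norm `‖ ‖f(·)‖_X ‖_E` of `E(X)`. -/
def bochnerNorm (f : E.bochner X) : ℝ := E.nrm ⟨aeNorm 𝕜 (f : B →ₘ[ν] X), f.2⟩

theorem bochnerNorm_add_le (f g : E.bochner X) :
    E.bochnerNorm (f + g) ≤ E.bochnerNorm f + E.bochnerNorm g := by
  refine le_trans ?_ (map_add_le_add E.nrm _ _)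
  refine E.nrm_mono' _ _ ?_
  filter_upwards [aeNorm_norm 𝕜 (f + g : B →ₘ[ν] X),
    AEEqFun.coeFn_add (f : B →ₘ[ν] X) (g : B →ₘ[ν] X),
    AEEqFun.coeFn_add (aeNorm 𝕜 (f : B →ₘ[ν] X)) (aeNorm 𝕜 (g : B →ₘ[ν] X)),
    AEEqFun.coeFn_comp (fun x : X => ((‖x‖ : ℝ) : 𝕜)) (by fun_prop) (f : B →ₘ[ν] X),
    AEEqFun.coeFn_comp (fun x : X => ((‖x‖ : ℝ) : 𝕜)) (by fun_prop) (g : B →ₘ[ν] X)]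
    with b h1 h2 h3 h4 h5
  have h6 : (aeNorm 𝕜 (f : B →ₘ[ν] X) + aeNorm 𝕜 (g : B →ₘ[ν] X)) b =
      ((‖(f : B →ₘ[ν] X) b‖ + ‖(g : B →ₘ[ν] X) b‖ : ℝ) : 𝕜) := by
    rw [h3]
    simp only [Pi.add_apply, aeNorm, h4, h5, Function.comp]
    push_cast; rfl
  simp only [Submodule.coe_add]
  rw [h1, h2, h6, RCLike.norm_ofReal, abs_of_nonneg (by positivity)]
  exact norm_add_le _ _

theorem bochnerNorm_smul (c : 𝕜) (f : E.bochner X) :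
    E.bochnerNorm (c • f) = ‖c‖ * E.bochnerNorm f := by
  rw [bochnerNorm, bochnerNorm, ← map_smul_eq_mul E.nrm]
  have key : ∀ᵐ b ∂ν, ‖aeNorm 𝕜 (c • (f : B →ₘ[ν] X)) b‖ =
      ‖(c • aeNorm 𝕜 (f : B →ₘ[ν] X)) b‖ := by
    filter_upwards [aeNorm_norm 𝕜 (c • (f : B →ₘ[ν] X)), aeNorm_norm 𝕜 (f : B →ₘ[ν] X),
      AEEqFun.coeFn_smul c (f : B →ₘ[ν] X),
      AEEqFun.coeFn_smul c (aeNorm 𝕜 (f : B →ₘ[ν] X))] with b h1 h2 h3 h4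
    rw [h1, h3, h4, Pi.smul_apply, Pi.smul_apply, norm_smul, norm_smul, h2]
  exact le_antisymm (E.nrm_mono' _ _ (key.mono fun b h => h.le))
    (E.nrm_mono' _ _ (key.mono fun b h => h.ge))

theorem eq_zero_of_bochnerNorm (f : E.bochner X) (hf : E.bochnerNorm f = 0) : f = 0 := by
  have h : aeNorm 𝕜 (f : B →ₘ[ν] X) = 0 := congrArg Subtype.val (E.eq_zero_of_nrm' _ hf)
  apply Subtype.ext
  apply AEEqFun.ext
  have h0 := AEEqFun.coeFn_zero (α := B) (μ := ν) (β := 𝕜)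
  filter_upwards [aeNorm_norm 𝕜 (f : B →ₘ[ν] X), h0,
    AEEqFun.coeFn_zero (α := B) (μ := ν) (β := X)] with b h1 h2 h3
  rw [h, h2] at h1
  simp only [Submodule.coe_zero]
  rw [h3]
  simpa using h1.symm

instance instBochnerNormedAddCommGroup : NormedAddCommGroup (E.bochner X) :=
  AddGroupNorm.toNormedAddCommGroup
    { toFun := E.bochnerNorm
      map_zero' := by simpa using E.bochnerNorm_smul (0 : 𝕜) (0 : E.bochner X)
      add_le' := E.bochnerNorm_add_le
      neg' := fun f => by
        rw [← neg_one_smul 𝕜 f, E.bochnerNorm_smul]; simp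
      eq_zero_of_map_eq_zero' := E.eq_zero_of_bochnerNorm }

instance instBochnerNormedSpace : NormedSpace 𝕜 (E.bochner X) where
  norm_smul_le c f := (E.bochnerNorm_smul c f).le

variable {E}

/-- The elementary tensor `f ⊗ x` as an element of `E(X)`. -/
def tensor (f : E) (x : X) : E.bochner X :=
  ⟨aeTensor (f : B →ₘ[ν] 𝕜) x, by
    refine E.ideal' _ _ (E.carrier.smul_mem ((‖x‖ : ℝ) : 𝕜) f.2) ?_
    filter_upwards [aeNorm_norm 𝕜 (aeTensor (f : B →ₘ[ν] 𝕜) x),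
      aeTensor_coe (f : B →ₘ[ν] 𝕜) x,
      AEEqFun.coeFn_smul ((‖x‖ : ℝ) : 𝕜) (f : B →ₘ[ν] 𝕜)] with b h1 h2 h3
    rw [h1, h2, h3, Pi.smul_apply, norm_smul, norm_smul, RCLike.norm_ofReal, abs_norm, mul_comm]⟩

variable (E X)

/-- The space `E ⊗̃ X`: the closure in `E(X)` of the linear span of the elementary tensors. -/
def tensorClosure : Submodule 𝕜 (E.bochner X) :=
  (Submodule.span 𝕜 {h | ∃ (f : E) (x : X), h = tensor f x}).topologicalClosure

end BanachFunctionSpace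

section Duality

variable {𝕜 : Type*} [RCLike 𝕜]

/-- A Banach duality between the Banach spaces `X` and `Y`: a bounded bilinear form that
separates the points of both spaces. -/
def IsBanachDualPair {X Y : Type*} [NormedAddCommGroup X] [NormedSpace 𝕜 X]
    [NormedAddCommGroup Y] [NormedSpace 𝕜 Y] (p : X →L[𝕜] Y →L[𝕜] 𝕜) : Prop :=
  Function.Injective p ∧ Function.Injective p.flip

variable {B : Type*} [MeasurableSpace B] {ν : Measure B}

/-- `⟨F, G⟩` is a Köthe dual pair with pairing `p`: it is a Banach dual pair, `F · G ⊆ L¹`, and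
the pairing is given by integration. -/
def IsKotheDualPair (F G : BanachFunctionSpace 𝕜 ν) (p : F →L[𝕜] G →L[𝕜] 𝕜) : Prop :=
  IsBanachDualPair p ∧
    ∀ (f : F) (g : G),
      Integrable (fun b => (f : B →ₘ[ν] 𝕜) b * (g : B →ₘ[ν] 𝕜) b) ν ∧
        p f g = ∫ b, (f : B →ₘ[ν] 𝕜) b * (g : B →ₘ[ν] 𝕜) b ∂ν

/-- The weak topology `σ(V, W)` on `V` induced by a pairing of `V` and `W`: the coarsest topology
for which all the functions `⟨·, w⟩` are continuous. -/
abbrev weakTopology {V W : Type*} (p : V → W → 𝕜) : TopologicalSpace V :=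
  TopologicalSpace.induced p Pi.topologicalSpace

/-- The value at `f` of the modulus `|φ|` of a functional `φ ∈ F*`, for `f ≥ 0`:
the supremum of `|φ h|` over all `h ∈ F` with `|h| ≤ |f|`. -/
def dualModulus {F : BanachFunctionSpace 𝕜 ν} (φ : F →L[𝕜] 𝕜) (f : F) : ℝ :=
  sSup {r | ∃ h : F, (∀ᵐ b ∂ν, ‖(h : B →ₘ[ν] 𝕜) b‖ ≤ ‖(f : B →ₘ[ν] 𝕜) b‖) ∧ r = ‖φ h‖}

/-- The order of the Banach lattice `F*`. -/
def dualLE {F : BanachFunctionSpace 𝕜 ν} (φ ψ : F →L[𝕜] 𝕜) : Prop :=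
  ∀ f : F, 0 ≤ f → φ f ≤ ψ f

/-- A linear subspace of `F*` is a band: it is solid (`|φ| ≤ |ψ|` and `ψ ∈ W` imply `φ ∈ W`) and
contains the supremum of each of its subsets that has a supremum in `F*`. -/
def IsDualBand {F : BanachFunctionSpace 𝕜 ν} (W : Submodule 𝕜 (F →L[𝕜] 𝕜)) : Prop :=
  (∀ φ ψ : F →L[𝕜] 𝕜, ψ ∈ W → (∀ f : F, 0 ≤ f → dualModulus φ f ≤ dualModulus ψ f) → φ ∈ W) ∧
    ∀ D : Set (F →L[𝕜] 𝕜), (∀ φ ∈ D, φ ∈ W) → ∀ s : F →L[𝕜] 𝕜,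
      (∀ φ ∈ D, dualLE φ s) → (∀ t : F →L[𝕜] 𝕜, (∀ φ ∈ D, dualLE φ t) → dualLE s t) → s ∈ W

end Duality

section Operators

variable {𝕜 : Type*} [RCLike 𝕜] {A B : Type*} [MeasurableSpace A] [MeasurableSpace B]
  {μ : Measure A} {ν : Measure B} {F G : BanachFunctionSpace 𝕜 ν}

/-- Positivity of a linear operator `L∞(A) → G`. -/
def IsPositiveOperator (R : Lp 𝕜 ∞ μ →ₗ[𝕜] G) : Prop :=
  ∀ f : Lp 𝕜 ∞ μ, 0 ≤ (f : A →ₘ[μ] 𝕜) → 0 ≤ R f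

/-- A linear operator is regular if it is a linear combination of positive operators. -/
def IsRegularOperator (T : Lp 𝕜 ∞ μ →ₗ[𝕜] G) : Prop :=
  T ∈ Submodule.span 𝕜 {R : Lp 𝕜 ∞ μ →ₗ[𝕜] G | IsPositiveOperator R}

/-- `T` is `σ(L∞(A), L¹(A))`-to-`σ(G, F)` continuous, where `p` is the pairing of `⟨F, G⟩`. -/
def IsWeakStarContinuous (p : F →L[𝕜] G →L[𝕜] 𝕜) (T : Lp 𝕜 ∞ μ →L[𝕜] G) : Prop :=
  Continuous[weakTopology (fun (e : Lp 𝕜 ∞ μ) (d : Lp 𝕜 1 μ) => ∫ a, d a * e a ∂μ),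
    weakTopology (fun (g : G) (f : F) => p f g)] T

/-- For a Banach dual pair `⟨X, Y⟩` with pairing `q`: the operator `T ⊗ I_Y` extends to a bounded
linear operator `L∞(A; Y) → G(Y)` that is `σ(L∞(A; Y), L¹(A; X))`-to-`σ(G(Y), F ⊗̃ X)`
continuous. -/
def HasWeakStarExtension (F : BanachFunctionSpace 𝕜 ν) (T : Lp 𝕜 ∞ μ →L[𝕜] G)
    {X Y : Type*} [NormedAddCommGroup X] [NormedSpace 𝕜 X]
    [NormedAddCommGroup Y] [NormedSpace 𝕜 Y] (q : X →L[𝕜] Y →L[𝕜] 𝕜) : Prop :=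
  ∃ TY : Lp Y ∞ μ →L[𝕜] G.bochner Y,
    (∀ (e : Lp 𝕜 ∞ μ) (y : Y),
      TY ((ContinuousLinearMap.toSpanSingleton 𝕜 y).compLp e) =
        BanachFunctionSpace.tensor (T e) y) ∧
    Continuous[weakTopology (fun (e : Lp Y ∞ μ) (d : Lp X 1 μ) => ∫ a, q (d a) (e a) ∂μ),
      weakTopology (fun (g : G.bochner Y) (f : F.tensorClosure X) =>
        ∫ b, q (((f : F.bochner X) : B →ₘ[ν] X) b) ((g : B →ₘ[ν] Y) b) ∂ν)] TY

end Operators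

end

/-! `T` is regular as soon as, for every `e ≥ 0` in `L∞(A)`, the sums `∑ |T fᵢ|` over finite
decompositions `e = ∑ fᵢ` with `fᵢ ≥ 0` have a supremum `S e` in `G`. By Riesz refinement these sums
form an upward directed set and `S` is additive on the positive cone. Since `|T e| ≤ S e`, the maps
`S + Re T` and `S + Im T` are positive there, and `T = (S + Re T) - S + i((S + Im T) - S)`; this is
`isRegularOperator_of_isLUB_variationSet`. It remains to bound the sums and to find their supremum.

If `G` has a Levi norm and `Y = ℓ¹`, let `δᵢ` be the unit vectors and `h = ∑ fᵢ ⊗ δᵢ`. Then `‖h(·)‖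
= ∑ fᵢ = e` and `‖(T_Y h)(·)‖ = ∑ |T fᵢ|`, so the sums have norm at most `‖T_Y‖ ‖e‖`, and the Levi
property gives the supremum.

If `G` is a band in `F*` and `X = ℓ¹`, weak continuity yields an adjoint `F ⊗̃ ℓ¹ → L¹(A; ℓ¹)`,
bounded by a closed graph argument (`exists_mem_adjointGraph_norm_le`). Write `|T fᵢ| = Uᵢ T fᵢ`
with phases `Uᵢ`, which may be taken simple by approximation. Cutting `f ∈ F` along the level sets
of `U = (Uᵢ)` and placing the pieces in different coordinates of `ℓ¹` gives an element of norm at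
most `‖f‖`; its adjoint image controls `⟨f, ∑ |T fᵢ|⟩` by `C ‖f‖ ‖e‖`
(`norm_pairing_sum_modulus_le`). The sums are thus bounded in `F*`. By Banach–Alaoglu they have a
supremum in `F*`, and the band property puts it in `G` (`exists_isLUB_of_isDualBand`). -/

noncomputable section

/-! ### Pointwise calculus in a Banach function space. -/

namespace BanachFunctionSpace

variable {𝕜 : Type*} [RCLike 𝕜] {B : Type*} [MeasurableSpace B] {ν : Measure B}

theorem norm_le_norm_of_ae_le {E : BanachFunctionSpace 𝕜 ν} {f g : E}
    (h : ∀ᵐ b ∂ν, ‖(f : B →ₘ[ν] 𝕜) b‖ ≤ ‖(g : B →ₘ[ν] 𝕜) b‖) : ‖f‖ ≤ ‖g‖ :=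
  E.nrm_mono' f g h

/-- The class of a measurable function dominated by an element of `E`. -/
def ofLE {E : BanachFunctionSpace 𝕜 ν} (h : B → 𝕜) (hm : AEStronglyMeasurable h ν) (g : E)
    (hg : ∀ᵐ b ∂ν, ‖h b‖ ≤ ‖(g : B →ₘ[ν] 𝕜) b‖) : E :=
  ⟨AEEqFun.mk h hm, E.ideal' _ g g.2 (by
    filter_upwards [hg, AEEqFun.coeFn_mk h hm] with b h1 h2
    rwa [h2])⟩

theorem coeFn_ofLE {E : BanachFunctionSpace 𝕜 ν} (h : B → 𝕜) (hm : AEStronglyMeasurable h ν)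
    (g : E) (hg : ∀ᵐ b ∂ν, ‖h b‖ ≤ ‖(g : B →ₘ[ν] 𝕜) b‖) :
    ∀ᵐ b ∂ν, (ofLE h hm g hg : B →ₘ[ν] 𝕜) b = h b :=
  AEEqFun.coeFn_mk h hm

theorem coeFn_add {E : BanachFunctionSpace 𝕜 ν} (f g : E) :
    ∀ᵐ b ∂ν, ((f + g : E) : B →ₘ[ν] 𝕜) b = (f : B →ₘ[ν] 𝕜) b + (g : B →ₘ[ν] 𝕜) b :=
  AEEqFun.coeFn_add (f : B →ₘ[ν] 𝕜) (g : B →ₘ[ν] 𝕜)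

theorem coeFn_sub {E : BanachFunctionSpace 𝕜 ν} (f g : E) :
    ∀ᵐ b ∂ν, ((f - g : E) : B →ₘ[ν] 𝕜) b = (f : B →ₘ[ν] 𝕜) b - (g : B →ₘ[ν] 𝕜) b :=
  AEEqFun.coeFn_sub (f : B →ₘ[ν] 𝕜) (g : B →ₘ[ν] 𝕜)

theorem coeFn_smul {E : BanachFunctionSpace 𝕜 ν} (c : 𝕜) (f : E) :
    ∀ᵐ b ∂ν, ((c • f : E) : B →ₘ[ν] 𝕜) b = c * (f : B →ₘ[ν] 𝕜) b :=
  AEEqFun.coeFn_smul c (f : B →ₘ[ν] 𝕜)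

theorem coeFn_zero {E : BanachFunctionSpace 𝕜 ν} :
    ∀ᵐ b ∂ν, ((0 : E) : B →ₘ[ν] 𝕜) b = 0 :=
  AEEqFun.coeFn_zero

theorem coeFn_sum {E : BanachFunctionSpace 𝕜 ν} {ι : Type*} (s : Finset ι) (f : ι → E) :
    ∀ᵐ b ∂ν, ((∑ i ∈ s, f i : E) : B →ₘ[ν] 𝕜) b = ∑ i ∈ s, (f i : B →ₘ[ν] 𝕜) b := by
  classical
  induction s using Finset.induction_on with
  | empty => simpa using coeFn_zero (E := E)
  | insert i s hi ih =>
    rw [Finset.sum_insert hi]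
    filter_upwards [coeFn_add (f i) (∑ j ∈ s, f j), ih] with b h1 h2
    rw [h1, h2, Finset.sum_insert hi]

theorem ext_ae {E : BanachFunctionSpace 𝕜 ν} {f g : E}
    (h : ∀ᵐ b ∂ν, (f : B →ₘ[ν] 𝕜) b = (g : B →ₘ[ν] 𝕜) b) : f = g :=
  Subtype.ext (AEEqFun.ext h)

theorem le_iff_ae {E : BanachFunctionSpace 𝕜 ν} {f g : E} :
    f ≤ g ↔ ∀ᵐ b ∂ν, (f : B →ₘ[ν] 𝕜) b ≤ (g : B →ₘ[ν] 𝕜) b :=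
  (AEEqFun.coeFn_le (f := (f : B →ₘ[ν] 𝕜)) (g := (g : B →ₘ[ν] 𝕜))).symm

theorem nonneg_iff_ae {E : BanachFunctionSpace 𝕜 ν} {f : E} :
    0 ≤ f ↔ ∀ᵐ b ∂ν, 0 ≤ (f : B →ₘ[ν] 𝕜) b := by
  rw [le_iff_ae]
  have h0 := coeFn_zero (E := E)
  constructor <;> intro h <;> filter_upwards [h, h0] with b h1 h2
  · rwa [h2] at h1
  · rwa [h2]

instance instIsOrderedAddMonoid (E : BanachFunctionSpace 𝕜 ν) : IsOrderedAddMonoid E.carrier where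
  add_le_add_left f g hfg h := by
    rw [le_iff_ae] at hfg ⊢
    filter_upwards [hfg, coeFn_add f h, coeFn_add g h] with b h1 h2 h3
    rw [h2, h3]
    gcongr

theorem smul_le_smul_of_nonneg {E : BanachFunctionSpace 𝕜 ν} {f g : E} (hfg : f ≤ g) {c : 𝕜}
    (hc : 0 ≤ c) : c • f ≤ c • g := by
  rw [le_iff_ae] at hfg ⊢
  filter_upwards [hfg, coeFn_smul c f, coeFn_smul c g] with b h1 h2 h3
  rw [h2, h3]
  exact mul_le_mul_of_nonneg_left h1 hc

/-- The modulus of an element of a Banach function space. -/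
def modulus {E : BanachFunctionSpace 𝕜 ν} (f : E) : E :=
  ⟨aeNorm 𝕜 (f : B →ₘ[ν] 𝕜), E.ideal' _ f f.2 (by
    filter_upwards [aeNorm_norm 𝕜 (f : B →ₘ[ν] 𝕜)] with b hb using hb.le)⟩

theorem coeFn_aeNorm {X : Type*} [NormedAddCommGroup X] (f : B →ₘ[ν] X) :
    ∀ᵐ b ∂ν, aeNorm 𝕜 f b = ((‖f b‖ : ℝ) : 𝕜) :=
  AEEqFun.coeFn_comp (fun x : X => ((‖x‖ : ℝ) : 𝕜)) (by fun_prop) f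

theorem coeFn_modulus {E : BanachFunctionSpace 𝕜 ν} (f : E) :
    ∀ᵐ b ∂ν, (modulus f : B →ₘ[ν] 𝕜) b = ((‖(f : B →ₘ[ν] 𝕜) b‖ : ℝ) : 𝕜) :=
  coeFn_aeNorm (f : B →ₘ[ν] 𝕜)

theorem modulus_nonneg {E : BanachFunctionSpace 𝕜 ν} (f : E) : 0 ≤ modulus f := by
  rw [nonneg_iff_ae]
  filter_upwards [coeFn_modulus f] with b hb
  rw [hb]
  exact RCLike.ofReal_nonneg.2 (norm_nonneg _)

theorem modulus_sum_le {E : BanachFunctionSpace 𝕜 ν} {ι : Type*} (s : Finset ι) (f : ι → E) :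
    modulus (∑ i ∈ s, f i) ≤ ∑ i ∈ s, modulus (f i) := by
  rw [le_iff_ae]
  have h1 : ∀ᵐ b ∂ν, ∀ i ∈ s,
      (modulus (f i) : B →ₘ[ν] 𝕜) b = ((‖(f i : B →ₘ[ν] 𝕜) b‖ : ℝ) : 𝕜) :=
    (ae_ball_iff s.countable_toSet).2 fun i _ => coeFn_modulus (f i)
  filter_upwards [coeFn_modulus (∑ i ∈ s, f i), coeFn_sum s f,
    coeFn_sum s fun i => modulus (f i), h1] with b h2 h3 h4 h5
  rw [h2, h3, h4, Finset.sum_congr rfl h5, ← RCLike.ofReal_sum, RCLike.ofReal_le_ofReal]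
  exact norm_sum_le _ _

theorem modulus_smul_of_nonneg {E : BanachFunctionSpace 𝕜 ν} {c : ℝ} (hc : 0 ≤ c) (f : E) :
    modulus ((c : 𝕜) • f) = (c : 𝕜) • modulus f := by
  apply ext_ae
  filter_upwards [coeFn_modulus f, coeFn_modulus ((c : 𝕜) • f), coeFn_smul (c : 𝕜) f,
    coeFn_smul (c : 𝕜) (modulus f)] with b h1 h2 h3 h4
  rw [h2, h3, h4, h1, norm_mul, RCLike.norm_ofReal, abs_of_nonneg hc, RCLike.ofReal_mul]

/-- The real part of an element of a Banach function space. -/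
def rePart {E : BanachFunctionSpace 𝕜 ν} (f : E) : E :=
  ofLE (fun b => ((RCLike.re ((f : B →ₘ[ν] 𝕜) b) : ℝ) : 𝕜))
    ((RCLike.continuous_ofReal.comp RCLike.continuous_re).comp_aestronglyMeasurable
      (AEEqFun.aestronglyMeasurable _)) f
    (ae_of_all _ fun b => by rw [RCLike.norm_ofReal]; exact RCLike.abs_re_le_norm _)

theorem coeFn_rePart {E : BanachFunctionSpace 𝕜 ν} (f : E) :
    ∀ᵐ b ∂ν, (rePart f : B →ₘ[ν] 𝕜) b = ((RCLike.re ((f : B →ₘ[ν] 𝕜) b) : ℝ) : 𝕜) :=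
  coeFn_ofLE _ _ _ _

/-- The imaginary part of an element of a Banach function space. -/
def imPart {E : BanachFunctionSpace 𝕜 ν} (f : E) : E :=
  ofLE (fun b => ((RCLike.im ((f : B →ₘ[ν] 𝕜) b) : ℝ) : 𝕜))
    ((RCLike.continuous_ofReal.comp RCLike.continuous_im).comp_aestronglyMeasurable
      (AEEqFun.aestronglyMeasurable _)) f
    (ae_of_all _ fun b => by rw [RCLike.norm_ofReal]; exact RCLike.abs_im_le_norm _)

theorem coeFn_imPart {E : BanachFunctionSpace 𝕜 ν} (f : E) :
    ∀ᵐ b ∂ν, (imPart f : B →ₘ[ν] 𝕜) b = ((RCLike.im ((f : B →ₘ[ν] 𝕜) b) : ℝ) : 𝕜) :=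
  coeFn_ofLE _ _ _ _

theorem rePart_add_I_smul_imPart {E : BanachFunctionSpace 𝕜 ν} (f : E) :
    rePart f + (RCLike.I : 𝕜) • imPart f = f := by
  apply ext_ae
  filter_upwards [coeFn_add (rePart f) ((RCLike.I : 𝕜) • imPart f),
    coeFn_smul (RCLike.I : 𝕜) (imPart f), coeFn_rePart f, coeFn_imPart f] with b h1 h2 h3 h4
  rw [h1, h2, h3, h4, mul_comm, RCLike.re_add_im]

theorem rePart_add {E : BanachFunctionSpace 𝕜 ν} (f g : E) :
    rePart (f + g) = rePart f + rePart g := by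
  apply ext_ae
  filter_upwards [coeFn_add (rePart f) (rePart g), coeFn_add f g, coeFn_rePart f, coeFn_rePart g,
    coeFn_rePart (f + g)] with b h1 h2 h3 h4 h5
  rw [h5, h1, h2, h3, h4, map_add, RCLike.ofReal_add]

theorem imPart_add {E : BanachFunctionSpace 𝕜 ν} (f g : E) :
    imPart (f + g) = imPart f + imPart g := by
  apply ext_ae
  filter_upwards [coeFn_add (imPart f) (imPart g), coeFn_add f g, coeFn_imPart f, coeFn_imPart g,
    coeFn_imPart (f + g)] with b h1 h2 h3 h4 h5
  rw [h5, h1, h2, h3, h4, map_add, RCLike.ofReal_add]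

theorem rePart_ofReal_smul {E : BanachFunctionSpace 𝕜 ν} (c : ℝ) (f : E) :
    rePart ((c : 𝕜) • f) = (c : 𝕜) • rePart f := by
  apply ext_ae
  filter_upwards [coeFn_smul (c : 𝕜) f, coeFn_smul (c : 𝕜) (rePart f), coeFn_rePart f,
    coeFn_rePart ((c : 𝕜) • f)] with b h1 h2 h3 h4
  rw [h4, h1, h2, h3, RCLike.re_ofReal_mul, RCLike.ofReal_mul]

theorem imPart_ofReal_smul {E : BanachFunctionSpace 𝕜 ν} (c : ℝ) (f : E) :
    imPart ((c : 𝕜) • f) = (c : 𝕜) • imPart f := by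
  apply ext_ae
  filter_upwards [coeFn_smul (c : 𝕜) f, coeFn_smul (c : 𝕜) (imPart f), coeFn_imPart f,
    coeFn_imPart ((c : 𝕜) • f)] with b h1 h2 h3 h4
  rw [h4, h1, h2, h3, RCLike.im_ofReal_mul, RCLike.ofReal_mul]

theorem modulus_add_rePart_nonneg {E : BanachFunctionSpace 𝕜 ν} (f : E) :
    0 ≤ modulus f + rePart f := by
  rw [nonneg_iff_ae]
  filter_upwards [coeFn_add (modulus f) (rePart f), coeFn_modulus f, coeFn_rePart f]
    with b h1 h2 h3
  rw [h1, h2, h3, ← RCLike.ofReal_add, RCLike.ofReal_nonneg]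
  linarith [neg_abs_le (RCLike.re ((f : B →ₘ[ν] 𝕜) b)),
    RCLike.abs_re_le_norm ((f : B →ₘ[ν] 𝕜) b)]

theorem modulus_add_imPart_nonneg {E : BanachFunctionSpace 𝕜 ν} (f : E) :
    0 ≤ modulus f + imPart f := by
  rw [nonneg_iff_ae]
  filter_upwards [coeFn_add (modulus f) (imPart f), coeFn_modulus f, coeFn_imPart f]
    with b h1 h2 h3
  rw [h1, h2, h3, ← RCLike.ofReal_add, RCLike.ofReal_nonneg]
  linarith [neg_abs_le (RCLike.im ((f : B →ₘ[ν] 𝕜) b)),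
    RCLike.abs_im_le_norm ((f : B →ₘ[ν] 𝕜) b)]

instance instCompleteSpace (E : BanachFunctionSpace 𝕜 ν) : CompleteSpace E.carrier := by
  refine Metric.complete_of_cauchySeq_tendsto fun u hu => ?_
  obtain ⟨f, hf⟩ := E.complete' u fun ε hε => by
    obtain ⟨N, hN⟩ := Metric.cauchySeq_iff.1 hu ε hε
    exact ⟨N, fun m hm n hn => by simpa only [dist_eq_norm] using! hN m hm n hn⟩
  exact ⟨f, tendsto_iff_norm_sub_tendsto_zero.2 hf⟩

end BanachFunctionSpace

/-! ### The positive cone of `L∞`: linear extension and Riesz refinement. -/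

section Linfty

variable {𝕜 : Type*} [RCLike 𝕜] {A : Type*} [MeasurableSpace A] {μ : Measure A}

theorem Linfty.nonneg_iff_ae {u : Lp 𝕜 ∞ μ} :
    0 ≤ (u : A →ₘ[μ] 𝕜) ↔ ∀ᵐ a ∂μ, 0 ≤ u a := by
  rw [← AEEqFun.coeFn_le]
  have h0 := AEEqFun.coeFn_zero (α := A) (μ := μ) (β := 𝕜)
  constructor <;> intro h <;> filter_upwards [h, h0] with b h1 h2
  · rw [h2] at h1; exact h1
  · rw [h2]; exact h1

theorem Linfty.add_nonneg {u v : Lp 𝕜 ∞ μ} (hu : 0 ≤ (u : A →ₘ[μ] 𝕜))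
    (hv : 0 ≤ (v : A →ₘ[μ] 𝕜)) : 0 ≤ ((u + v : Lp 𝕜 ∞ μ) : A →ₘ[μ] 𝕜) := by
  rw [nonneg_iff_ae] at *
  filter_upwards [hu, hv, Lp.coeFn_add u v] with a h1 h2 h3
  rw [h3]
  exact _root_.add_nonneg h1 h2

theorem Linfty.smul_nonneg {u : Lp 𝕜 ∞ μ} (hu : 0 ≤ (u : A →ₘ[μ] 𝕜)) {c : ℝ} (hc : 0 ≤ c) :
    0 ≤ (((c : 𝕜) • u : Lp 𝕜 ∞ μ) : A →ₘ[μ] 𝕜) := by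
  rw [nonneg_iff_ae] at *
  filter_upwards [hu, Lp.coeFn_smul (c : 𝕜) u] with a h1 h3
  rw [h3]
  exact mul_nonneg (RCLike.ofReal_nonneg.2 hc) h1

theorem Linfty.zero_nonneg : 0 ≤ ((0 : Lp 𝕜 ∞ μ) : A →ₘ[μ] 𝕜) := le_refl _

theorem RCLike.norm_le_norm_of_nonneg {x y : 𝕜} (hx : 0 ≤ x) (hxy : x ≤ y) : ‖x‖ ≤ ‖y‖ := by
  have h := hxy
  rw [← RCLike.norm_of_nonneg' hx, ← RCLike.norm_of_nonneg' (hx.trans hxy)] at h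
  exact RCLike.ofReal_le_ofReal.1 h

theorem RCLike.lipschitzWith_max_re :
    LipschitzWith 1 (fun x : 𝕜 => ((max (RCLike.re x) 0 : ℝ) : 𝕜)) := by
  refine LipschitzWith.of_dist_le_mul fun x y => ?_
  rw [dist_eq_norm, dist_eq_norm, ← RCLike.ofReal_sub, RCLike.norm_ofReal, NNReal.coe_one, one_mul]
  refine (abs_max_sub_max_le_abs _ _ _).trans ?_
  rw [← map_sub]
  exact RCLike.abs_re_le_norm _

/-- The positive part of the real part of a bounded function. -/
def Linfty.rePos (u : Lp 𝕜 ∞ μ) : Lp 𝕜 ∞ μ :=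
  RCLike.lipschitzWith_max_re.compLp (by simp) u

theorem Linfty.coeFn_rePos (u : Lp 𝕜 ∞ μ) :
    ∀ᵐ a ∂μ, rePos u a = ((max (RCLike.re (u a)) 0 : ℝ) : 𝕜) :=
  RCLike.lipschitzWith_max_re.coeFn_compLp (by simp) u

theorem Linfty.rePos_nonneg (u : Lp 𝕜 ∞ μ) : 0 ≤ (rePos u : A →ₘ[μ] 𝕜) := by
  rw [nonneg_iff_ae]
  filter_upwards [coeFn_rePos u] with a ha
  rw [ha, RCLike.ofReal_nonneg]
  exact le_max_right _ _

theorem Linfty.rePos_sub_rePos_neg (u : Lp 𝕜 ∞ μ) :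
    ∀ᵐ a ∂μ, rePos u a - rePos (-u) a = ((RCLike.re (u a) : ℝ) : 𝕜) := by
  filter_upwards [coeFn_rePos u, coeFn_rePos (-u), Lp.coeFn_neg u] with a h1 h2 h3
  rw [h1, h2, h3, ← RCLike.ofReal_sub, Pi.neg_apply, map_neg]
  congr 1
  rcases le_total 0 (RCLike.re (u a)) with h | h
  · rw [max_eq_left h, max_eq_right (by linarith)]; ring
  · rw [max_eq_right h, max_eq_left (by linarith)]; ring

/-- This is the independence needed to extend `Q` from the cone: the difference `Q u - Q v` depends
only on `u - v`, so any convenient splitting of `Re e` may replace the canonical one. -/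
theorem Linfty.sub_eq_of_re_eq {V : Type*} [AddCommGroup V] {Q : Lp 𝕜 ∞ μ → V}
    (hadd : ∀ u v : Lp 𝕜 ∞ μ, 0 ≤ (u : A →ₘ[μ] 𝕜) → 0 ≤ (v : A →ₘ[μ] 𝕜) → Q (u + v) = Q u + Q v)
    {e u v : Lp 𝕜 ∞ μ} (hu : 0 ≤ (u : A →ₘ[μ] 𝕜)) (hv : 0 ≤ (v : A →ₘ[μ] 𝕜))
    (h : ∀ᵐ a ∂μ, u a - v a = ((RCLike.re (e a) : ℝ) : 𝕜)) :
    Q (rePos e) - Q (rePos (-e)) = Q u - Q v := by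
  have h1 : rePos e + v = u + rePos (-e) := by
    apply Lp.ext
    filter_upwards [h, rePos_sub_rePos_neg e, Lp.coeFn_add (rePos e) v,
      Lp.coeFn_add u (rePos (-e))] with a h1 h2 h3 h4
    rw [h3, h4, Pi.add_apply, Pi.add_apply]
    linear_combination h2 - h1
  have h2 := congrArg Q h1
  rw [hadd _ _ (rePos_nonneg e) hv, hadd _ _ hu (rePos_nonneg (-e))] at h2
  rw [sub_eq_sub_iff_add_eq_add, h2]

/-- A map that is additive and positively homogeneous on the positive cone of `L∞` agrees there
with a linear map. -/
theorem Linfty.exists_linearMap_eq_on_nonneg {V : Type*} [AddCommGroup V] [Module 𝕜 V]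
    {Q : Lp 𝕜 ∞ μ → V}
    (hadd : ∀ u v : Lp 𝕜 ∞ μ, 0 ≤ (u : A →ₘ[μ] 𝕜) → 0 ≤ (v : A →ₘ[μ] 𝕜) → Q (u + v) = Q u + Q v)
    (hsmul : ∀ (c : ℝ) (u : Lp 𝕜 ∞ μ), 0 ≤ c → 0 ≤ (u : A →ₘ[μ] 𝕜) →
      Q ((c : 𝕜) • u) = (c : 𝕜) • Q u) :
    ∃ L : Lp 𝕜 ∞ μ →ₗ[𝕜] V, ∀ u : Lp 𝕜 ∞ μ, 0 ≤ (u : A →ₘ[μ] 𝕜) → L u = Q u := by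
  set R : Lp 𝕜 ∞ μ → V := fun e => Q (rePos e) - Q (rePos (-e)) with hR
  have key : ∀ e u v : Lp 𝕜 ∞ μ, 0 ≤ (u : A →ₘ[μ] 𝕜) → 0 ≤ (v : A →ₘ[μ] 𝕜) →
      (∀ᵐ a ∂μ, u a - v a = ((RCLike.re (e a) : ℝ) : 𝕜)) → R e = Q u - Q v :=
    fun e u v hu hv h => sub_eq_of_re_eq hadd hu hv h
  have Q0 : Q 0 = 0 := by
    simpa using hsmul 0 0 le_rfl zero_nonneg
  have Radd : ∀ e e', R (e + e') = R e + R e' := by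
    intro e e'
    rw [key (e + e') (rePos e + rePos e') (rePos (-e) + rePos (-e'))
      (add_nonneg (rePos_nonneg _) (rePos_nonneg _)) (add_nonneg (rePos_nonneg _) (rePos_nonneg _)),
      hadd _ _ (rePos_nonneg _) (rePos_nonneg _), hadd _ _ (rePos_nonneg _) (rePos_nonneg _)]
    · exact add_sub_add_comm _ _ _ _
    · filter_upwards [rePos_sub_rePos_neg e, rePos_sub_rePos_neg e', Lp.coeFn_add e e',
        Lp.coeFn_add (rePos e) (rePos e'), Lp.coeFn_add (rePos (-e)) (rePos (-e'))]
        with a h1 h2 h3 h4 h5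
      rw [h3, h4, h5]
      simp only [Pi.add_apply, map_add]
      linear_combination h1 + h2
  have Rneg : ∀ e, R (-e) = - R e := by
    intro e
    simp [hR]
  have Rpos : ∀ (c : ℝ) (e), 0 ≤ c → R ((c : 𝕜) • e) = (c : 𝕜) • R e := by
    intro c e hc
    rw [key ((c : 𝕜) • e) ((c : 𝕜) • rePos e) ((c : 𝕜) • rePos (-e))
      (smul_nonneg (rePos_nonneg _) hc) (smul_nonneg (rePos_nonneg _) hc),
      hsmul _ _ hc (rePos_nonneg _), hsmul _ _ hc (rePos_nonneg _), smul_sub]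
    filter_upwards [rePos_sub_rePos_neg e, Lp.coeFn_smul (c : 𝕜) e,
      Lp.coeFn_smul (c : 𝕜) (rePos e), Lp.coeFn_smul (c : 𝕜) (rePos (-e))] with a h1 h2 h3 h4
    rw [h2, h3, h4]
    simp only [Pi.smul_apply, smul_eq_mul, RCLike.re_ofReal_mul, RCLike.ofReal_mul]
    linear_combination (c : 𝕜) * h1
  have Rreal : ∀ (c : ℝ) (e), R ((c : 𝕜) • e) = (c : 𝕜) • R e := by
    intro c e
    rcases le_total 0 c with hc | hc
    · exact Rpos c e hc
    · have h := Rpos (-c) e (by linarith)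
      rw [RCLike.ofReal_neg, neg_smul, neg_smul, Rneg] at h
      exact neg_injective h
  -- `R` sees only the real part, and `Re (-I e) = Im e`, so this is the complex-linear extension of
  -- `R`. Over `ℝ` one has `I = 0` and the second term vanishes.
  set L : Lp 𝕜 ∞ μ → V := fun e => R e + (RCLike.I : 𝕜) • R (-((RCLike.I : 𝕜) • e)) with hL
  have Ladd : ∀ e e', L (e + e') = L e + L e' := by
    intro e e'
    simp only [hL, smul_add, neg_add, Radd]
    abel
  have Lreal : ∀ (c : ℝ) (e), L ((c : 𝕜) • e) = (c : 𝕜) • L e := by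
    intro c e
    simp only [hL, smul_add]
    rw [Rreal, smul_comm (RCLike.I : 𝕜) (c : 𝕜) e, ← smul_neg, Rreal, smul_comm]
  have LI : ∀ e, L ((RCLike.I : 𝕜) • e) = (RCLike.I : 𝕜) • L e := by
    intro e
    rcases (RCLike.I_mul_I (K := 𝕜)) with h | h
    · have h0 : R 0 = 0 := by simp [hR]
      simp [hL, h, h0]
    · simp only [hL, smul_add, smul_smul, h, Rneg, neg_smul, one_smul, neg_neg]
      exact add_comm _ _
  refine ⟨⟨⟨L, Ladd⟩, fun c e => ?_⟩, fun u hu => ?_⟩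
  · change L (c • e) = c • L e
    conv_lhs => rw [← RCLike.re_add_im c]
    rw [add_smul, Ladd, Lreal, mul_smul, Lreal, LI, ← mul_smul, ← add_smul, RCLike.re_add_im]
  · change R u + (RCLike.I : 𝕜) • R (-((RCLike.I : 𝕜) • u)) = Q u
    rw [nonneg_iff_ae] at hu
    rw [key u u 0 (nonneg_iff_ae.2 hu) zero_nonneg, key _ 0 0 zero_nonneg zero_nonneg, Q0]
    · simp
    · filter_upwards [hu, Lp.coeFn_neg ((RCLike.I : 𝕜) • u), Lp.coeFn_smul (RCLike.I : 𝕜) u]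
        with a h1 h2 h3
      rw [h2, Pi.neg_apply, h3, Pi.smul_apply, smul_eq_mul, map_neg, RCLike.I_mul_re,
        (RCLike.nonneg_iff.1 h1).2]
      simp
    · filter_upwards [hu, Lp.coeFn_zero 𝕜 ∞ μ] with a h1 h2
      rw [h2, Pi.zero_apply, sub_zero]
      exact (RCLike.nonneg_iff_exists_ofReal.1 h1).elim fun r hr => by simp [← hr.2]

theorem Linfty.eq_rePos_decomposition (u : Lp 𝕜 ∞ μ) :
    u = rePos u - rePos (-u) +
      (RCLike.I : 𝕜) • (rePos (-((RCLike.I : 𝕜) • u)) - rePos (-(-((RCLike.I : 𝕜) • u)))) := by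
  set v := -((RCLike.I : 𝕜) • u) with hv
  apply Lp.ext
  filter_upwards [rePos_sub_rePos_neg u, rePos_sub_rePos_neg v,
    Lp.coeFn_add (rePos u - rePos (-u)) ((RCLike.I : 𝕜) • (rePos v - rePos (-v))),
    Lp.coeFn_sub (rePos u) (rePos (-u)), Lp.coeFn_sub (rePos v) (rePos (-v)),
    Lp.coeFn_smul (RCLike.I : 𝕜) (rePos v - rePos (-v)),
    Lp.coeFn_neg ((RCLike.I : 𝕜) • u), Lp.coeFn_smul (RCLike.I : 𝕜) u] with a h1 h2 h3 h4 h5 h6 h7 h8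
  rw [h3, Pi.add_apply, h4, h6, Pi.smul_apply, h5, Pi.sub_apply, Pi.sub_apply, h1, h2, hv, h7,
    Pi.neg_apply, h8, Pi.smul_apply, smul_eq_mul, smul_eq_mul, map_neg, RCLike.I_mul_re, neg_neg,
    mul_comm, RCLike.re_add_im]

theorem Linfty.linearMap_eq_of_eq_on_nonneg {V : Type*} [AddCommGroup V] [Module 𝕜 V]
    {S T : Lp 𝕜 ∞ μ →ₗ[𝕜] V} (h : ∀ u : Lp 𝕜 ∞ μ, 0 ≤ (u : A →ₘ[μ] 𝕜) → S u = T u)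
    (u : Lp 𝕜 ∞ μ) : S u = T u := by
  rw [eq_rePos_decomposition u]
  simp only [map_add, map_sub, map_smul, h _ (rePos_nonneg _)]

/-- Bounded functions have the Riesz refinement property. -/
theorem Linfty.exists_refinement {ι κ : Type*} [Fintype ι] [Fintype κ] (f : ι → Lp 𝕜 ∞ μ)
    (g : κ → Lp 𝕜 ∞ μ) (hf : ∀ i, 0 ≤ (f i : A →ₘ[μ] 𝕜)) (hg : ∀ j, 0 ≤ (g j : A →ₘ[μ] 𝕜))
    (hfg : ∑ i, f i = ∑ j, g j) :
    ∃ h : ι → κ → Lp 𝕜 ∞ μ, (∀ i j, 0 ≤ (h i j : A →ₘ[μ] 𝕜)) ∧ (∀ i, ∑ j, h i j = f i) ∧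
      ∀ j, ∑ i, h i j = g j := by
  set e : Lp 𝕜 ∞ μ := ∑ i, f i with he
  have hf' : ∀ᵐ a ∂μ, ∀ i, 0 ≤ f i a := ae_all_iff.2 fun i => nonneg_iff_ae.1 (hf i)
  have hg' : ∀ᵐ a ∂μ, ∀ j, 0 ≤ g j a := ae_all_iff.2 fun j => nonneg_iff_ae.1 (hg j)
  have hef : ∀ᵐ a ∂μ, e a = ∑ i, f i a := by
    filter_upwards [Lp.coeFn_finsetSum Finset.univ f] with a ha
    rw [he, ha, Finset.sum_apply]
  have heg : ∀ᵐ a ∂μ, e a = ∑ j, g j a := by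
    filter_upwards [Lp.coeFn_finsetSum Finset.univ g] with a ha
    rw [hfg, ha, Finset.sum_apply]
  -- The refinement is `fᵢ gⱼ / e`, bounded by `fᵢ` because `0 ≤ gⱼ ≤ e`. Where `e = 0` the quotient
  -- is `0` by convention, which is the right value since all `fᵢ` and `gⱼ` vanish there.
  have hle : ∀ i j, ∀ᵐ a ∂μ, ‖f i a * g j a / e a‖ ≤ ‖f i a‖ := by
    intro i j
    filter_upwards [hg', heg] with a h1 h2
    have h3 : ‖g j a‖ ≤ ‖e a‖ := by
      have : g j a ≤ e a := by
        rw [h2]; exact Finset.single_le_sum (f := fun j => g j a) (fun j _ => h1 j) (Finset.mem_univ j)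
      exact RCLike.norm_le_norm_of_nonneg (h1 j) this
    rw [norm_div, norm_mul]
    exact div_le_of_le_mul₀ (norm_nonneg _) (norm_nonneg _)
      (mul_le_mul_of_nonneg_left h3 (norm_nonneg _))
  have hm : ∀ i j, MemLp (fun a => f i a * g j a / e a) ∞ μ := fun i j =>
    (Lp.memLp (f i)).mono (((Lp.aestronglyMeasurable (f i)).mul
      (Lp.aestronglyMeasurable (g j))).div₀ (Lp.aestronglyMeasurable e)) (hle i j)
  have hh : ∀ᵐ a ∂μ, ∀ i j, (hm i j).toLp _ a = f i a * g j a / e a :=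
    ae_all_iff.2 fun i => ae_all_iff.2 fun j => (hm i j).coeFn_toLp
  refine ⟨fun i j => (hm i j).toLp _, fun i j => ?_, fun i => ?_, fun j => ?_⟩
  · rw [nonneg_iff_ae]
    filter_upwards [hh, hf', hg', hef] with a h1 h2 h3 h4
    rw [h1]
    have : 0 ≤ e a := by rw [h4]; exact Finset.sum_nonneg fun i _ => h2 i
    exact div_nonneg (mul_nonneg (h2 i) (h3 j)) this
  · apply Lp.ext
    filter_upwards [hh, hf', hef, heg, Lp.coeFn_finsetSum Finset.univ fun j => (hm i j).toLp _]
      with a h1 h2 h3 h4 h5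
    rw [h5]
    simp only [Finset.sum_apply, h1]
    rw [← Finset.sum_div, ← Finset.mul_sum, ← h4]
    by_cases h0 : e a = 0
    · rw [h3, Finset.sum_eq_zero_iff_of_nonneg fun i _ => h2 i] at h0
      simp [h0 i (Finset.mem_univ i)]
    · exact mul_div_cancel_right₀ _ h0
  · apply Lp.ext
    filter_upwards [hh, hg', hef, heg, Lp.coeFn_finsetSum Finset.univ fun i => (hm i j).toLp _]
      with a h1 h2 h3 h4 h5
    rw [h5]
    simp only [Finset.sum_apply, h1]
    rw [← Finset.sum_div, ← Finset.sum_mul, ← h3]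
    by_cases h0 : e a = 0
    · rw [h4, Finset.sum_eq_zero_iff_of_nonneg fun i _ => h2 i] at h0
      simp [h0 j (Finset.mem_univ j)]
    · exact mul_div_cancel_left₀ _ h0

end Linfty

/-! ### The modulus of an operator as a supremum over decompositions. -/

section Variation

open BanachFunctionSpace

variable {𝕜 : Type*} [RCLike 𝕜] {A B : Type*} [MeasurableSpace A] [MeasurableSpace B]
  {μ : Measure A} {ν : Measure B} {G : BanachFunctionSpace 𝕜 ν}

/-- The sums `∑ |T fᵢ|` over all finite families of positive functions `fᵢ` with sum `e`. -/
def variationSet (T : Lp 𝕜 ∞ μ →ₗ[𝕜] G) (e : Lp 𝕜 ∞ μ) : Set G :=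
  {d | ∃ (n : ℕ) (f : Fin n → Lp 𝕜 ∞ μ), (∀ i, 0 ≤ (f i : A →ₘ[μ] 𝕜)) ∧ ∑ i, f i = e ∧
    d = ∑ i, modulus (T (f i))}

/-- Frees the index type from `Fin n`, so that products and disjoint unions of decompositions can be
used directly. -/
theorem sum_modulus_mem_variationSet (T : Lp 𝕜 ∞ μ →ₗ[𝕜] G) {ι : Type*} [Fintype ι]
    {f : ι → Lp 𝕜 ∞ μ} (hf : ∀ i, 0 ≤ (f i : A →ₘ[μ] 𝕜)) :
    ∑ i, modulus (T (f i)) ∈ variationSet T (∑ i, f i) := by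
  let k := (Fintype.equivFin ι).symm
  exact ⟨Fintype.card ι, fun i => f (k i), fun i => hf _, k.sum_comp f,
    (k.sum_comp fun i => modulus (T (f i))).symm⟩

theorem modulus_mem_variationSet (T : Lp 𝕜 ∞ μ →ₗ[𝕜] G) {e : Lp 𝕜 ∞ μ}
    (he : 0 ≤ (e : A →ₘ[μ] 𝕜)) : modulus (T e) ∈ variationSet T e := by
  simpa using sum_modulus_mem_variationSet T (ι := Unit) (f := fun _ => e) fun _ => he

theorem nonneg_of_mem_variationSet {T : Lp 𝕜 ∞ μ →ₗ[𝕜] G} {e : Lp 𝕜 ∞ μ} {d : G}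
    (hd : d ∈ variationSet T e) : 0 ≤ d := by
  obtain ⟨n, f, -, -, rfl⟩ := hd
  exact Finset.sum_nonneg fun i _ => modulus_nonneg _

/-- Two decompositions of `e` have a common refinement, and refining can only increase the sum, by
the triangle inequality for the modulus. -/
theorem directedOn_variationSet (T : Lp 𝕜 ∞ μ →ₗ[𝕜] G) (e : Lp 𝕜 ∞ μ) :
    DirectedOn (· ≤ ·) (variationSet T e) := by
  rintro _ ⟨m, f, hf, hfe, rfl⟩ _ ⟨n, g, hg, hge, rfl⟩
  obtain ⟨h, h0, h1, h2⟩ := Linfty.exists_refinement f g hf hg (hfe.trans hge.symm)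
  have h3 := sum_modulus_mem_variationSet T (f := fun x : Fin m × Fin n => h x.1 x.2)
    fun x => h0 _ _
  rw [Fintype.sum_prod_type, Fintype.sum_prod_type] at h3
  simp only [h1, hfe] at h3
  refine ⟨_, h3, ?_, ?_⟩
  · refine Finset.sum_le_sum fun i _ => ?_
    rw [← h1 i, map_sum]
    exact modulus_sum_le _ _
  · rw [Finset.sum_comm]
    refine Finset.sum_le_sum fun j _ => ?_
    rw [← h2 j, map_sum]
    exact modulus_sum_le _ _

/-- For the upper bound, a decomposition of `u + v` is refined against the pair `u`, `v`. For
minimality, decompositions of `u` and of `v` are concatenated into one of `u + v`. -/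
theorem isLUB_variationSet_add {T : Lp 𝕜 ∞ μ →ₗ[𝕜] G} {u v : Lp 𝕜 ∞ μ} {s t : G}
    (hu : 0 ≤ (u : A →ₘ[μ] 𝕜)) (hv : 0 ≤ (v : A →ₘ[μ] 𝕜)) (hs : IsLUB (variationSet T u) s)
    (ht : IsLUB (variationSet T v) t) : IsLUB (variationSet T (u + v)) (s + t) := by
  constructor
  · rintro _ ⟨n, f, hf, hfe, rfl⟩
    obtain ⟨h, h0, h1, h2⟩ := Linfty.exists_refinement f (fun b : Bool => cond b u v) hf
      (fun b => by cases b <;> assumption) (by simpa using hfe)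
    have hs' := hs.1 (by simpa [h2] using sum_modulus_mem_variationSet T fun i => h0 i true)
    have ht' := ht.1 (by simpa [h2] using sum_modulus_mem_variationSet T fun i => h0 i false)
    refine le_trans ?_ (add_le_add hs' ht')
    rw [← Finset.sum_add_distrib]
    refine Finset.sum_le_sum fun i _ => ?_
    rw [← h1 i, map_sum]
    refine (modulus_sum_le _ _).trans ?_
    simp
  · intro w hw
    refine add_le_of_le_sub_right (hs.2 fun a ha => le_sub_iff_add_le.2 ?_)
    rw [add_comm]
    refine add_le_of_le_sub_right (ht.2 fun b hb => le_sub_iff_add_le.2 (hw ?_))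
    obtain ⟨m, f, hf, rfl, rfl⟩ := ha
    obtain ⟨n, g, hg, rfl, rfl⟩ := hb
    have := sum_modulus_mem_variationSet T (f := Sum.elim f g)
      (fun x => by cases x <;> simp [hf, hg])
    simpa [add_comm] using this

theorem isLUB_variationSet_smul {T : Lp 𝕜 ∞ μ →ₗ[𝕜] G} {u : Lp 𝕜 ∞ μ} {s : G} {c : ℝ}
    (hc : 0 < c) (hs : IsLUB (variationSet T u) s) :
    IsLUB (variationSet T ((c : 𝕜) • u)) ((c : 𝕜) • s) := by
  -- Decompositions scale; applied with both `c` and `c⁻¹`, this makes scaling by `c` a bijection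
  -- between the two sets of sums.
  have key : ∀ (r : ℝ) (w : Lp 𝕜 ∞ μ) (d : G), 0 ≤ r → d ∈ variationSet T w →
      (r : 𝕜) • d ∈ variationSet T ((r : 𝕜) • w) := by
    rintro r _ _ hr ⟨n, f, hf, rfl, rfl⟩
    refine ⟨n, fun i => (r : 𝕜) • f i, fun i => Linfty.smul_nonneg (hf i) hr,
      Finset.smul_sum.symm, ?_⟩
    simp only [map_smul, modulus_smul_of_nonneg hr, Finset.smul_sum]
  have hcc : ((c⁻¹ : ℝ) : 𝕜) * (c : 𝕜) = 1 := by
    rw [← RCLike.ofReal_mul, inv_mul_cancel₀ hc.ne', RCLike.ofReal_one]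
  constructor
  · intro d hd
    have h1 := hs.1 (by
      have := key c⁻¹ _ _ (inv_nonneg.2 hc.le) hd
      rwa [smul_smul, hcc, one_smul] at this)
    have h2 := smul_le_smul_of_nonneg h1 (RCLike.ofReal_nonneg (K := 𝕜).2 hc.le)
    rwa [smul_smul, mul_comm, hcc, one_smul] at h2
  · intro w hw
    have h1 : s ≤ ((c⁻¹ : ℝ) : 𝕜) • w := hs.2 fun d hd => by
      have := smul_le_smul_of_nonneg (hw (key c _ _ hc.le hd))
        (RCLike.ofReal_nonneg (K := 𝕜).2 (inv_nonneg.2 hc.le))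
      rwa [smul_smul, hcc, one_smul] at this
    have h2 := smul_le_smul_of_nonneg h1 (RCLike.ofReal_nonneg (K := 𝕜).2 hc.le)
    rwa [smul_smul, mul_comm, hcc, one_smul] at h2

theorem isLUB_variationSet_zero (T : Lp 𝕜 ∞ μ →ₗ[𝕜] G) : IsLUB (variationSet T 0) 0 := by
  constructor
  · rintro _ ⟨n, f, hf, h0, rfl⟩
    refine (Finset.sum_eq_zero fun i _ => ?_).le
    have h1 : f i = 0 := by
      apply Lp.ext
      filter_upwards [Lp.coeFn_finsetSum Finset.univ f, Lp.coeFn_zero 𝕜 ∞ μ,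
        ae_all_iff.2 fun j => Linfty.nonneg_iff_ae.1 (hf j)] with a h1 h2 h3
      rw [h0, h2, Pi.zero_apply, Finset.sum_apply] at h1
      rw [h2, Pi.zero_apply]
      exact (Finset.sum_eq_zero_iff_of_nonneg fun j _ => h3 j).1 h1.symm i (Finset.mem_univ i)
    rw [h1, map_zero]
    simpa using modulus_smul_of_nonneg le_rfl (0 : G)
  · intro w hw
    exact (modulus_nonneg _).trans (hw (modulus_mem_variationSet T (Linfty.zero_nonneg)))

/-- If all the suprema that define the modulus of an operator `L∞(A) → G` exist, then the operator
is regular. -/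
theorem isRegularOperator_of_isLUB_variationSet (T : Lp 𝕜 ∞ μ →ₗ[𝕜] G)
    (h : ∀ e : Lp 𝕜 ∞ μ, 0 ≤ (e : A →ₘ[μ] 𝕜) → ∃ s, IsLUB (variationSet T e) s) :
    IsRegularOperator T := by
  -- The value `0` off the cone is arbitrary; it makes `S` a total function.
  have h' : ∀ e : Lp 𝕜 ∞ μ, ∃ s, 0 ≤ (e : A →ₘ[μ] 𝕜) → IsLUB (variationSet T e) s := fun e => by
    by_cases he : 0 ≤ (e : A →ₘ[μ] 𝕜)
    · exact (h e he).imp fun s hs _ => hs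
    · exact ⟨0, fun h => (he h).elim⟩
  choose S hS using h'
  have Sadd : ∀ u v : Lp 𝕜 ∞ μ, 0 ≤ (u : A →ₘ[μ] 𝕜) → 0 ≤ (v : A →ₘ[μ] 𝕜) →
      S (u + v) = S u + S v := fun u v hu hv =>
    (hS _ (Linfty.add_nonneg hu hv)).unique (isLUB_variationSet_add hu hv (hS u hu) (hS v hv))
  have Ssmul : ∀ (c : ℝ) (u : Lp 𝕜 ∞ μ), 0 ≤ c → 0 ≤ (u : A →ₘ[μ] 𝕜) →
      S ((c : 𝕜) • u) = (c : 𝕜) • S u := by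
    intro c u hc hu
    refine (hS _ (Linfty.smul_nonneg hu hc)).unique ?_
    rcases hc.eq_or_lt with rfl | hc
    · simpa using isLUB_variationSet_zero T
    · exact isLUB_variationSet_smul hc (hS u hu)
  have Sle : ∀ u : Lp 𝕜 ∞ μ, 0 ≤ (u : A →ₘ[μ] 𝕜) → modulus (T u) ≤ S u := fun u hu =>
    (hS u hu).1 (modulus_mem_variationSet T hu)
  obtain ⟨L, hL⟩ := Linfty.exists_linearMap_eq_on_nonneg Sadd Ssmul
  obtain ⟨L₁, hL₁⟩ := Linfty.exists_linearMap_eq_on_nonneg (Q := fun u => S u + rePart (T u))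
    (fun u v hu hv => by
      simp only [Sadd u v hu hv, map_add, rePart_add]
      exact add_add_add_comm _ _ _ _)
    (fun c u hc hu => by
      simp only [Ssmul c u hc hu, map_smul, rePart_ofReal_smul, smul_add])
  obtain ⟨L₂, hL₂⟩ := Linfty.exists_linearMap_eq_on_nonneg (Q := fun u => S u + imPart (T u))
    (fun u v hu hv => by
      simp only [Sadd u v hu hv, map_add, imPart_add]
      exact add_add_add_comm _ _ _ _)
    (fun c u hc hu => by
      simp only [Ssmul c u hc hu, map_smul, imPart_ofReal_smul, smul_add])
  have hpos : IsPositiveOperator L := fun u hu => by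
    rw [hL u hu]
    exact (modulus_nonneg _).trans (Sle u hu)
  have hpos₁ : IsPositiveOperator L₁ := fun u hu => by
    rw [hL₁ u hu]
    exact (modulus_add_rePart_nonneg (T u)).trans (by gcongr; exact Sle u hu)
  have hpos₂ : IsPositiveOperator L₂ := fun u hu => by
    rw [hL₂ u hu]
    exact (modulus_add_imPart_nonneg (T u)).trans (by gcongr; exact Sle u hu)
  have hT : ∀ u : Lp 𝕜 ∞ μ, 0 ≤ (u : A →ₘ[μ] 𝕜) →
      T u = (L₁ - L + (RCLike.I : 𝕜) • (L₂ - L)) u := by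
    intro u hu
    simp only [LinearMap.add_apply, LinearMap.sub_apply, LinearMap.smul_apply, hL u hu, hL₁ u hu,
      hL₂ u hu, add_sub_cancel_left, rePart_add_I_smul_imPart]
  have hT' : T = L₁ - L + (RCLike.I : 𝕜) • (L₂ - L) := by
    ext1 u
    exact Linfty.linearMap_eq_of_eq_on_nonneg hT u
  unfold IsRegularOperator
  rw [hT']
  have m : ∀ {R : Lp 𝕜 ∞ μ →ₗ[𝕜] G}, IsPositiveOperator R →
      R ∈ Submodule.span 𝕜 {R : Lp 𝕜 ∞ μ →ₗ[𝕜] G | IsPositiveOperator R} :=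
    fun hR => Submodule.subset_span hR
  exact Submodule.add_mem _ (Submodule.sub_mem _ (m hpos₁) (m hpos))
    (Submodule.smul_mem _ _ (Submodule.sub_mem _ (m hpos₂) (m hpos)))

end Variation

/-! ### Sums over distinct unit vectors of `ℓ¹`, whose norm is a sum of moduli. -/

theorem lp.norm_sum_smul_single {𝕜 : Type*} [RCLike 𝕜] {ι : Type*} [Fintype ι] {k : ι → ℕ}
    (hk : Function.Injective k) (c : ι → 𝕜) :
    ‖∑ j, c j • (lp.single 1 (k j) 1 : lp (fun _ : ℕ => 𝕜) 1)‖ = ∑ j, ‖c j‖ := by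
  classical
  -- The coefficients are carried to `ℕ` along `k`, with `0` off its range; only the finite image of
  -- `k` enters the sum.
  have h := lp.norm_sum_single (E := fun _ : ℕ => 𝕜) (p := 1) (by simp)
    (fun m => Function.extend k c 0 m) (Finset.univ.image k)
  rw [Finset.sum_image fun i _ j _ h => hk h, Finset.sum_image fun i _ j _ h => hk h] at h
  simp only [hk.extend_apply, ENNReal.toReal_one, Real.rpow_one] at h
  rw [← h]
  congr 1
  refine Finset.sum_congr rfl fun j _ => ?_
  rw [← lp.single_smul, smul_eq_mul, mul_one]

namespace BanachFunctionSpace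

variable {𝕜 : Type*} [RCLike 𝕜] {B : Type*} [MeasurableSpace B] {ν : Measure B}
  {E : BanachFunctionSpace 𝕜 ν} {X : Type*} [NormedAddCommGroup X] [NormedSpace 𝕜 X]

theorem coeFn_tensor (f : E) (x : X) :
    ∀ᵐ b ∂ν, ((tensor f x : E.bochner X) : B →ₘ[ν] X) b = (f : B →ₘ[ν] 𝕜) b • x :=
  aeTensor_coe _ _

theorem bochner_coeFn_sum {ι : Type*} (s : Finset ι) (f : ι → E.bochner X) :
    ∀ᵐ b ∂ν, ((∑ i ∈ s, f i : E.bochner X) : B →ₘ[ν] X) b = ∑ i ∈ s, (f i : B →ₘ[ν] X) b := by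
  classical
  induction s using Finset.induction_on with
  | empty =>
    filter_upwards [AEEqFun.coeFn_zero (α := B) (μ := ν) (β := X)] with b hb
    simpa using hb
  | insert i s hi ih =>
    rw [Finset.sum_insert hi]
    filter_upwards [AEEqFun.coeFn_add (f i : B →ₘ[ν] X) ((∑ j ∈ s, f j : E.bochner X) : B →ₘ[ν] X),
      ih] with b h1 h2
    rw [Submodule.coe_add, h1, Pi.add_apply, h2, Finset.sum_insert hi]

theorem bochner_norm_le_of_ae_le {f : E.bochner X} {g : E}
    (h : ∀ᵐ b ∂ν, ‖(f : B →ₘ[ν] X) b‖ ≤ ‖(g : B →ₘ[ν] 𝕜) b‖) : ‖f‖ ≤ ‖g‖ :=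
  E.nrm_mono' ⟨aeNorm 𝕜 (f : B →ₘ[ν] X), f.2⟩ g (by
    filter_upwards [h, aeNorm_norm 𝕜 (f : B →ₘ[ν] X)] with b h1 h2
    rwa [h2])

theorem norm_le_bochner_norm_of_ae_le {f : E.bochner X} {g : E}
    (h : ∀ᵐ b ∂ν, ‖(g : B →ₘ[ν] 𝕜) b‖ ≤ ‖(f : B →ₘ[ν] X) b‖) : ‖g‖ ≤ ‖f‖ :=
  E.nrm_mono' g ⟨aeNorm 𝕜 (f : B →ₘ[ν] X), f.2⟩ (by
    filter_upwards [h, aeNorm_norm 𝕜 (f : B →ₘ[ν] X)] with b h1 h2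
    rwa [h2])

theorem norm_coeFn_sum_tensor_single {ι : Type*} [Fintype ι] {k : ι → ℕ}
    (hk : Function.Injective k) (f : ι → E) :
    ∀ᵐ b ∂ν, ‖((∑ j, tensor (f j) (lp.single 1 (k j) 1 : lp (fun _ : ℕ => 𝕜) 1) :
      E.bochner (lp (fun _ : ℕ => 𝕜) 1)) : B →ₘ[ν] lp (fun _ : ℕ => 𝕜) 1) b‖ =
      ∑ j, ‖(f j : B →ₘ[ν] 𝕜) b‖ := by
  filter_upwards [bochner_coeFn_sum Finset.univ fun j =>
    (tensor (f j) (lp.single 1 (k j) 1 : lp (fun _ : ℕ => 𝕜) 1)),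
    ae_all_iff.2 fun j => coeFn_tensor (f j) (lp.single 1 (k j) 1 : lp (fun _ : ℕ => 𝕜) 1)]
    with b h1 h2
  rw [h1, ← lp.norm_sum_smul_single hk]
  simp only [h2]

end BanachFunctionSpace

theorem Lp.norm_coeFn_sum_single {𝕜 : Type*} [RCLike 𝕜] {A : Type*} [MeasurableSpace A]
    {μ : Measure A} {r : ℝ≥0∞} {ι : Type*} [Fintype ι] {k : ι → ℕ} (hk : Function.Injective k)
    (f : ι → Lp 𝕜 r μ) :
    ∀ᵐ a ∂μ, ‖(∑ j, (ContinuousLinearMap.toSpanSingleton 𝕜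
      (lp.single 1 (k j) 1 : lp (fun _ : ℕ => 𝕜) 1)).compLp (f j) :
        Lp (lp (fun _ : ℕ => 𝕜) 1) r μ) a‖ = ∑ j, ‖f j a‖ := by
  filter_upwards [Lp.coeFn_finsetSum Finset.univ fun j => (ContinuousLinearMap.toSpanSingleton 𝕜
      (lp.single 1 (k j) 1 : lp (fun _ : ℕ => 𝕜) 1)).compLp (f j),
    ae_all_iff.2 fun j => (ContinuousLinearMap.toSpanSingleton 𝕜
      (lp.single 1 (k j) 1 : lp (fun _ : ℕ => 𝕜) 1)).coeFn_compLp (f j)] with a h1 h2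
  rw [h1, ← lp.norm_sum_smul_single hk, Finset.sum_apply]
  simp only [h2, ContinuousLinearMap.toSpanSingleton_apply]

/-! ### Case (i): Levi norms. -/

section Levi

open BanachFunctionSpace

variable {𝕜 : Type*} [RCLike 𝕜] {A B : Type*} [MeasurableSpace A] [MeasurableSpace B]
  {μ : Measure A} {ν : Measure B} {G : BanachFunctionSpace 𝕜 ν}

/-- An operator `L∞(A) → G` whose tensor product with the identity of `ℓ¹` is bounded is regular if
`G` has a Levi norm. -/
theorem BanachFunctionSpace.HasLeviNorm.isRegularOperator (hG : G.HasLeviNorm)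
    (T : Lp 𝕜 ∞ μ →L[𝕜] G)
    (TY : Lp (lp (fun _ : ℕ => 𝕜) 1) ∞ μ →L[𝕜] G.bochner (lp (fun _ : ℕ => 𝕜) 1))
    (hTY : ∀ (e : Lp 𝕜 ∞ μ) (y : lp (fun _ : ℕ => 𝕜) 1),
      TY ((ContinuousLinearMap.toSpanSingleton 𝕜 y).compLp e) = tensor (T e) y) :
    IsRegularOperator (T : Lp 𝕜 ∞ μ →ₗ[𝕜] G) := by
  refine isRegularOperator_of_isLUB_variationSet _ fun e he => hG _
    ⟨_, modulus_mem_variationSet _ he⟩ (fun d hd => nonneg_of_mem_variationSet hd)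
    (directedOn_variationSet _ e) ⟨‖TY‖ * ‖e‖, ?_⟩
  rintro _ ⟨n, f, hf, hfe, rfl⟩
  have hk : Function.Injective (Fin.val : Fin n → ℕ) := Fin.val_injective
  set h : Lp (lp (fun _ : ℕ => 𝕜) 1) ∞ μ := ∑ i : Fin n, (ContinuousLinearMap.toSpanSingleton 𝕜
    (lp.single 1 (i : ℕ) 1 : lp (fun _ : ℕ => 𝕜) 1)).compLp (f i) with hh
  -- The `fᵢ` are nonnegative, so the pointwise `ℓ¹` norm of `h` is `∑ fᵢ = e`, whatever the length
  -- of the decomposition.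
  have h1 : ‖h‖ ≤ ‖e‖ := by
    refine Lp.norm_le_norm_of_ae_le ?_
    filter_upwards [Lp.norm_coeFn_sum_single hk f, Lp.coeFn_finsetSum Finset.univ f,
      ae_all_iff.2 fun i => Linfty.nonneg_iff_ae.1 (hf i)] with a h1 h2 h3
    rw [h1, ← hfe, h2, Finset.sum_apply]
    have h4 : ∑ i, f i a = ((∑ i, ‖f i a‖ : ℝ) : 𝕜) := by
      rw [RCLike.ofReal_sum]
      exact Finset.sum_congr rfl fun i _ => (RCLike.norm_of_nonneg' (h3 i)).symm
    rw [h4, RCLike.norm_ofReal]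
    exact le_abs_self _
  have h2 : TY h = ∑ i : Fin n, tensor (T (f i)) (lp.single 1 (i : ℕ) 1 : lp (fun _ : ℕ => 𝕜) 1) := by
    rw [hh, map_sum]
    exact Finset.sum_congr rfl fun i _ => hTY _ _
  have h3 : ‖∑ i, modulus (T (f i))‖ ≤ ‖TY h‖ := by
    rw [h2]
    refine norm_le_bochner_norm_of_ae_le ?_
    filter_upwards [norm_coeFn_sum_tensor_single hk fun i => T (f i),
      BanachFunctionSpace.coeFn_sum Finset.univ fun i => modulus (T (f i)),
      ae_all_iff.2 fun i => coeFn_modulus (T (f i))] with b h1 h2 h3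
    rw [h1, h2]
    refine (norm_sum_le _ _).trans (Finset.sum_le_sum fun i _ => ?_)
    rw [h3, RCLike.norm_ofReal, abs_norm]
  exact h3.trans ((TY.le_opNorm h).trans (mul_le_mul_of_nonneg_left h1 (norm_nonneg _)))

end Levi

/-! ### Completeness of Köthe–Bochner spaces. -/

namespace BanachFunctionSpace

variable {𝕜 : Type*} [RCLike 𝕜] {B : Type*} [MeasurableSpace B] {ν : Measure B}
  {E : BanachFunctionSpace 𝕜 ν} {X : Type*} [NormedAddCommGroup X] [NormedSpace 𝕜 X]

theorem ae_re_le_of_tendsto {u : ℕ → E} {s : E} (hu : Tendsto u atTop (𝓝 s)) (k : ℕ)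
    (h : ∀ n ≥ k, ∀ᵐ b ∂ν,
      RCLike.re ((u k : B →ₘ[ν] 𝕜) b) ≤ RCLike.re ((u n : B →ₘ[ν] 𝕜) b)) :
    ∀ᵐ b ∂ν, RCLike.re ((u k : B →ₘ[ν] 𝕜) b) ≤ RCLike.re ((s : B →ₘ[ν] 𝕜) b) := by
  -- `w` is the positive part of `Re (u k - s)`. By monotonicity it is dominated by `|u n - s|` for
  -- all `n ≥ k`, hence has norm `0`.
  set w : E := ofLE
    (fun b => ((max (RCLike.re (((u k - s : E) : B →ₘ[ν] 𝕜) b)) 0 : ℝ) : 𝕜))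
    (RCLike.lipschitzWith_max_re.continuous.comp_aestronglyMeasurable
      (AEEqFun.aestronglyMeasurable _)) (u k - s) (ae_of_all _ fun b => by
        rw [RCLike.norm_ofReal, abs_of_nonneg (le_max_right _ _)]
        exact max_le ((le_abs_self _).trans (RCLike.abs_re_le_norm _)) (norm_nonneg _)) with hw
  have hwc : ∀ᵐ b ∂ν, (w : B →ₘ[ν] 𝕜) b =
      ((max (RCLike.re (((u k - s : E) : B →ₘ[ν] 𝕜) b)) 0 : ℝ) : 𝕜) := coeFn_ofLE _ _ _ _
  have h1 : ∀ n ≥ k, ‖w‖ ≤ ‖u n - s‖ := by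
    intro n hn
    refine norm_le_norm_of_ae_le ?_
    filter_upwards [hwc, h n hn, coeFn_sub (u k) s, coeFn_sub (u n) s] with b h1 h2 h3 h4
    rw [h1, h3, h4, RCLike.norm_ofReal, abs_of_nonneg (le_max_right _ _)]
    refine max_le (le_trans ?_ ((le_abs_self _).trans (RCLike.abs_re_le_norm _))) (norm_nonneg _)
    rw [map_sub, map_sub]
    linarith
  have h2 : ‖w‖ ≤ 0 := ge_of_tendsto (tendsto_iff_norm_sub_tendsto_zero.1 hu)
    (eventually_atTop.2 ⟨k, h1⟩)
  have h3 : w = 0 := norm_le_zero_iff.1 h2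
  rw [h3] at hwc
  filter_upwards [hwc, coeFn_zero (E := E), coeFn_sub (u k) s] with b h4 h5 h6
  rw [h5, eq_comm, RCLike.ofReal_eq_zero, h6, map_sub] at h4
  linarith [max_eq_right_iff.1 h4]

/-- The element `‖f(·)‖` of `E`. -/
def normFn (f : E.bochner X) : E := ⟨aeNorm 𝕜 (f : B →ₘ[ν] X), f.2⟩

theorem coeFn_normFn (f : E.bochner X) :
    ∀ᵐ b ∂ν, (normFn f : B →ₘ[ν] 𝕜) b = ((‖(f : B →ₘ[ν] X) b‖ : ℝ) : 𝕜) :=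
  coeFn_aeNorm _

theorem norm_normFn (f : E.bochner X) : ‖normFn f‖ = ‖f‖ := rfl

/-- A Riesz–Fischer argument: for an absolutely convergent series, the pointwise norms sum in `E` to
some `s`. Domination by `s` gives absolute convergence a.e., and the tail of the series is dominated
by the tail `s - σ n`, which tends to `0` in norm. -/
instance instBochnerCompleteSpace [CompleteSpace X] : CompleteSpace (E.bochner X) := by
  refine NormedAddCommGroup.completeSpace_of_summable_imp_tendsto fun u hu => ?_
  have hv : Summable fun n => normFn (u n) := Summable.of_norm (by simpa only [norm_normFn] using hu)
  obtain ⟨s, hs⟩ := hv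
  have hs := hs.tendsto_sum_nat
  set σ : ℕ → E := fun n => ∑ i ∈ Finset.range n, normFn (u i) with hσ
  have hσc : ∀ᵐ b ∂ν, ∀ n, (σ n : B →ₘ[ν] 𝕜) b =
      ((∑ i ∈ Finset.range n, ‖(u i : B →ₘ[ν] X) b‖ : ℝ) : 𝕜) := by
    filter_upwards [ae_all_iff.2 fun n =>
      coeFn_sum (Finset.range n) fun i => normFn (u i), ae_all_iff.2 fun i => coeFn_normFn (u i)]
      with b h1 h2 n
    rw [h1, RCLike.ofReal_sum]
    exact Finset.sum_congr rfl fun i _ => h2 i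
  have hle : ∀ᵐ b ∂ν, ∀ n, ∑ i ∈ Finset.range n, ‖(u i : B →ₘ[ν] X) b‖ ≤
      RCLike.re ((s : B →ₘ[ν] 𝕜) b) := by
    have := ae_all_iff.2 fun k => ae_re_le_of_tendsto hs k fun n hn => by
      filter_upwards [hσc] with b hb
      rw [hb, hb, RCLike.ofReal_re, RCLike.ofReal_re]
      exact Finset.sum_le_sum_of_subset_of_nonneg (Finset.range_mono hn)
        fun _ _ _ => norm_nonneg _
    filter_upwards [this, hσc] with b h1 h2 n
    have := h1 n
    rwa [h2, RCLike.ofReal_re] at this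
  have hsum : ∀ᵐ b ∂ν, Summable fun i => ‖(u i : B →ₘ[ν] X) b‖ := by
    filter_upwards [hle] with b hb
    exact summable_of_sum_range_le (fun _ => norm_nonneg _) hb
  have hm : AEStronglyMeasurable (fun b => ∑' i, (u i : B →ₘ[ν] X) b) ν := by
    refine aestronglyMeasurable_of_tendsto_ae atTop
      (f := fun n b => ∑ i ∈ Finset.range n, (u i : B →ₘ[ν] X) b)
      (fun n => Finset.aestronglyMeasurable_fun_sum _ fun i _ => AEEqFun.aestronglyMeasurable _) ?_
    filter_upwards [hsum] with b hb
    exact hb.of_norm.hasSum.tendsto_sum_nat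
  have htail : ∀ᵐ b ∂ν, ∀ n, ‖(∑' i, (u i : B →ₘ[ν] X) b) -
      ∑ i ∈ Finset.range n, (u i : B →ₘ[ν] X) b‖ ≤ ‖(s : B →ₘ[ν] 𝕜) b - (σ n : B →ₘ[ν] 𝕜) b‖ := by
    filter_upwards [hsum, hle, hσc] with b h1 h2 h3 n
    have h4 : (∑' i, (u i : B →ₘ[ν] X) b) - ∑ i ∈ Finset.range n, (u i : B →ₘ[ν] X) b =
        ∑' i, (u (i + n) : B →ₘ[ν] X) b := by
      rw [sub_eq_iff_eq_add', h1.of_norm.sum_add_tsum_nat_add]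
    have h5 : ∑' i, ‖(u i : B →ₘ[ν] X) b‖ ≤ RCLike.re ((s : B →ₘ[ν] 𝕜) b) :=
      Real.tsum_le_of_sum_range_le (fun _ => norm_nonneg _) h2
    have h6 := h1.sum_add_tsum_nat_add n
    have h8 : Summable fun i => ‖(u (i + n) : B →ₘ[ν] X) b‖ :=
      (summable_nat_add_iff (f := fun i => ‖(u i : B →ₘ[ν] X) b‖) n).2 h1
    have h7 := norm_tsum_le_tsum_norm h8
    rw [h4, h3]
    refine h7.trans (le_trans ?_ ((le_abs_self _).trans (RCLike.abs_re_le_norm _)))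
    rw [map_sub, RCLike.ofReal_re]
    linarith
  have hmem : AEEqFun.mk _ hm ∈ E.bochner X := by
    refine E.ideal' _ s s.2 ?_
    filter_upwards [aeNorm_norm 𝕜 (AEEqFun.mk _ hm), AEEqFun.coeFn_mk _ hm, htail, hσc]
      with b h1 h2 h3 h4
    rw [h1, h2]
    have := h3 0
    rw [h4 0] at this
    simpa using this
  refine ⟨⟨_, hmem⟩, tendsto_iff_norm_sub_tendsto_zero.2 ?_⟩
  refine squeeze_zero (fun _ => norm_nonneg _) (fun n => ?_)
    (tendsto_iff_norm_sub_tendsto_zero.1 hs)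
  refine bochner_norm_le_of_ae_le ?_
  filter_upwards [htail, coeFn_sub (σ n) s, bochner_coeFn_sum (Finset.range n) u,
    AEEqFun.coeFn_mk _ hm,
    AEEqFun.coeFn_sub ((∑ i ∈ Finset.range n, u i : E.bochner X) : B →ₘ[ν] X) (AEEqFun.mk _ hm)]
    with b h1 h2 h3 h4 h5
  rw [Submodule.coe_sub, h5, Pi.sub_apply, h3, h4, h2, norm_sub_rev, norm_sub_rev _ ((s : B →ₘ[ν] 𝕜) b)]
  exact h1 n

instance instTensorClosureCompleteSpace [CompleteSpace X] : CompleteSpace (E.tensorClosure X) :=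
  (Submodule.isClosed_topologicalClosure _).completeSpace_coe

theorem tensor_mem_tensorClosure (f : E) (x : X) : tensor f x ∈ E.tensorClosure X :=
  Submodule.le_topologicalClosure _ (Submodule.subset_span ⟨f, x, rfl⟩)

/-! ### The integral pairing of `F(X)` and `G(Y)`. -/

section Pairing

variable {F G : BanachFunctionSpace 𝕜 ν} {p : F →L[𝕜] G →L[𝕜] 𝕜}
  {Y : Type*} [NormedAddCommGroup Y] [NormedSpace 𝕜 Y]

theorem integrable_pairing (hp : IsKotheDualPair F G p) (q : X →L[𝕜] Y →L[𝕜] 𝕜)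
    (w : F.bochner X) (h : G.bochner Y) :
    Integrable (fun b => q ((w : B →ₘ[ν] X) b) ((h : B →ₘ[ν] Y) b)) ν := by
  refine ((hp.2 (normFn w) (normFn h)).1.const_mul (‖q‖ : 𝕜)).mono
    (q.aestronglyMeasurable_comp₂ (AEEqFun.aestronglyMeasurable _)
      (AEEqFun.aestronglyMeasurable _)) ?_
  filter_upwards [coeFn_normFn w, coeFn_normFn h] with b h1 h2
  rw [h1, h2, norm_mul, norm_mul]
  simp only [RCLike.norm_ofReal, abs_norm]
  rw [abs_of_nonneg (norm_nonneg q), ← mul_assoc]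
  exact q.le_opNorm₂ _ _

/-- The scalar pairing is applied to `‖w(·)‖ ∈ F` and `‖h(·)‖ ∈ G`, which dominate the integrand up
to `‖q‖`. -/
theorem norm_integral_pairing_le (hp : IsKotheDualPair F G p) (q : X →L[𝕜] Y →L[𝕜] 𝕜)
    (w : F.bochner X) (h : G.bochner Y) :
    ‖∫ b, q ((w : B →ₘ[ν] X) b) ((h : B →ₘ[ν] Y) b) ∂ν‖ ≤ ‖q‖ * ‖p‖ * ‖w‖ * ‖h‖ := by
  have key : ∀ᵐ b ∂ν, ‖(normFn w : B →ₘ[ν] 𝕜) b * (normFn h : B →ₘ[ν] 𝕜) b‖ =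
      ‖(w : B →ₘ[ν] X) b‖ * ‖(h : B →ₘ[ν] Y) b‖ := by
    filter_upwards [coeFn_normFn w, coeFn_normFn h] with b h1 h2
    rw [h1, h2, norm_mul, RCLike.norm_ofReal, RCLike.norm_ofReal, abs_norm, abs_norm]
  have h1 : p (normFn w) (normFn h) =
      ((∫ b, ‖(w : B →ₘ[ν] X) b‖ * ‖(h : B →ₘ[ν] Y) b‖ ∂ν : ℝ) : 𝕜) := by
    rw [(hp.2 _ _).2, ← integral_ofReal]
    refine integral_congr_ae ?_
    filter_upwards [coeFn_normFn w, coeFn_normFn h] with b h1 h2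
    rw [h1, h2, RCLike.ofReal_mul]
  have h2 : ∫ b, ‖(w : B →ₘ[ν] X) b‖ * ‖(h : B →ₘ[ν] Y) b‖ ∂ν ≤ ‖p‖ * ‖w‖ * ‖h‖ := by
    have := p.le_opNorm₂ (normFn w) (normFn h)
    rw [h1, RCLike.norm_ofReal, norm_normFn, norm_normFn] at this
    exact (le_abs_self _).trans this
  calc ‖∫ b, q ((w : B →ₘ[ν] X) b) ((h : B →ₘ[ν] Y) b) ∂ν‖
      ≤ ∫ b, ‖q‖ * (‖(w : B →ₘ[ν] X) b‖ * ‖(h : B →ₘ[ν] Y) b‖) ∂ν := by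
        refine norm_integral_le_of_norm_le ?_ (ae_of_all _ fun b => ?_)
        · exact ((hp.2 (normFn w) (normFn h)).1.norm.congr key).const_mul _
        · rw [← mul_assoc]
          exact q.le_opNorm₂ _ _
    _ ≤ ‖q‖ * (‖p‖ * ‖w‖ * ‖h‖) := by
        rw [integral_const_mul]
        exact mul_le_mul_of_nonneg_left h2 (norm_nonneg q)
    _ = _ := by ring

/-- The pairing of `F(X)` and `G(Y)` by integration. -/
def pairing (hp : IsKotheDualPair F G p) (q : X →L[𝕜] Y →L[𝕜] 𝕜) :
    F.bochner X →L[𝕜] G.bochner Y →L[𝕜] 𝕜 :=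
  LinearMap.mkContinuous₂
    (LinearMap.mk₂ 𝕜 (fun (w : F.bochner X) (h : G.bochner Y) =>
        ∫ b, q ((w : B →ₘ[ν] X) b) ((h : B →ₘ[ν] Y) b) ∂ν)
      (fun w w' h => by
        rw [← integral_add (integrable_pairing hp q w h) (integrable_pairing hp q w' h)]
        refine integral_congr_ae ?_
        filter_upwards [AEEqFun.coeFn_add (w : B →ₘ[ν] X) (w' : B →ₘ[ν] X)] with b hb
        rw [Submodule.coe_add, hb, Pi.add_apply, map_add, add_apply])
      (fun c w h => by
        rw [← integral_smul]
        refine integral_congr_ae ?_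
        filter_upwards [AEEqFun.coeFn_smul c (w : B →ₘ[ν] X)] with b hb
        rw [Submodule.coe_smul, hb, Pi.smul_apply, map_smul, smul_apply])
      (fun w h h' => by
        rw [← integral_add (integrable_pairing hp q w h) (integrable_pairing hp q w h')]
        refine integral_congr_ae ?_
        filter_upwards [AEEqFun.coeFn_add (h : B →ₘ[ν] Y) (h' : B →ₘ[ν] Y)] with b hb
        rw [Submodule.coe_add, hb, Pi.add_apply, map_add])
      (fun c w h => by
        rw [← integral_smul]
        refine integral_congr_ae ?_
        filter_upwards [AEEqFun.coeFn_smul c (h : B →ₘ[ν] Y)] with b hb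
        rw [Submodule.coe_smul, hb, Pi.smul_apply, map_smul]))
    (‖q‖ * ‖p‖) (norm_integral_pairing_le hp q)

theorem pairing_apply (hp : IsKotheDualPair F G p) (q : X →L[𝕜] Y →L[𝕜] 𝕜)
    (w : F.bochner X) (h : G.bochner Y) :
    pairing hp q w h = ∫ b, q ((w : B →ₘ[ν] X) b) ((h : B →ₘ[ν] Y) b) ∂ν := rfl

theorem pairing_tensor_tensor (hp : IsKotheDualPair F G p) (q : X →L[𝕜] Y →L[𝕜] 𝕜)
    (f : F) (x : X) (g : G) (y : Y) :
    pairing hp q (tensor f x) (tensor g y) = p f g * q x y := by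
  rw [pairing_apply, (hp.2 f g).2, ← integral_mul_const]
  refine integral_congr_ae ?_
  filter_upwards [coeFn_tensor f x, coeFn_tensor g y] with b h1 h2
  rw [h1, h2]
  simp only [map_smul, smul_apply, smul_eq_mul]
  ring

end Pairing

end BanachFunctionSpace

/-! ### Representation of weakly continuous functionals. -/

/-- A functional that factors through a weakly continuous operator is represented by an element of
the dual partner. -/
theorem exists_eq_of_continuous_weakTopology {𝕜 : Type*} [RCLike 𝕜] {V W V' W' : Type*}
    [AddCommGroup V] [Module 𝕜 V] [AddCommGroup W] [Module 𝕜 W] (P : V →ₗ[𝕜] W →ₗ[𝕜] 𝕜)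
    (p' : V' → W' → 𝕜) {T : V → V'}
    (hT : Continuous[weakTopology (fun v w => P v w), weakTopology p'] T) (w' : W')
    (φ : V →ₗ[𝕜] 𝕜) (hφ : ∀ v, φ v = p' (T v) w') : ∃ w, ∀ v, φ v = P v w := by
  have h1 : Continuous[weakTopology (fun v w => P v w), inferInstance] φ := by
    let t : TopologicalSpace V := weakTopology (fun v w => P v w)
    let t' : TopologicalSpace V' := weakTopology p'
    have h2 : Continuous fun v' : V' => p' v' w' :=
      (continuous_apply w').comp continuous_induced_dom
    have h3 : (φ : V → 𝕜) = fun v => p' (T v) w' := funext hφ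
    rw [h3]
    exact h2.comp hT
  let f : StrongDual 𝕜 (WeakBilin P) := { toLinearMap := φ, cont := h1 }
  obtain ⟨w, hw⟩ := LinearMap.dualEmbedding_surjective P f
  exact ⟨w, fun v => (congrArg (fun g : StrongDual 𝕜 (WeakBilin P) => g v) hw).symm⟩

/-- An integrable function that vanishes against all elementary tensors is zero. -/
theorem Lp.eq_zero_of_lpPairing_eq_zero {𝕜 : Type*} [RCLike 𝕜] {A : Type*} [MeasurableSpace A]
    {μ : Measure A} {X Y : Type*} [NormedAddCommGroup X] [NormedSpace 𝕜 X] [NormedAddCommGroup Y]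
    [NormedSpace 𝕜 Y] {q : X →L[𝕜] Y →L[𝕜] 𝕜} (hq : Function.Injective q) (d : Lp X 1 μ)
    (h : ∀ (e : Lp 𝕜 ∞ μ) (y : Y),
      q.lpPairing μ 1 ∞ d ((ContinuousLinearMap.toSpanSingleton 𝕜 y).compLp e) = 0) : d = 0 := by
  have h1 : ∀ y, ∀ᵐ a ∂μ, q (d a) y = 0 := by
    intro y
    have hi : Integrable (fun a => q (d a) y) μ :=
      (q.flip y).integrable_comp (L1.integrable_coeFn d)
    refine hi.ae_eq_zero_of_forall_setIntegral_eq_zero fun s hs hμs => ?_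
    have h2 := h (indicatorConstLp ∞ hs hμs.ne 1) y
    rw [ContinuousLinearMap.lpPairing_eq_integral] at h2
    rw [← h2, ← integral_indicator hs]
    refine integral_congr_ae ?_
    filter_upwards [(ContinuousLinearMap.toSpanSingleton 𝕜 y).coeFn_compLp
      (indicatorConstLp ∞ hs hμs.ne (1 : 𝕜)), indicatorConstLp_coeFn (p := ∞) (hs := hs)
      (hμs := hμs.ne) (c := (1 : 𝕜))] with a h3 h4
    rw [h3, h4]
    by_cases ha : a ∈ s <;> simp [ha]
  -- The null set in `h1` depends on `y`. The sets `{x | q x y ≠ 0}` cover the nonzero values of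
  -- `d`, which form a separable set, so by the Lindelöf property countably many `y` suffice.
  have hsep : TopologicalSpace.IsSeparable (Set.range d \ {0}) :=
    (Lp.stronglyMeasurable d).isSeparable_range.mono Set.sdiff_subset
  have := hsep.secondCountableTopology
  obtain ⟨S, hS, hSU⟩ := TopologicalSpace.isOpen_iUnion_countable
    (fun y : Y => {x : ↥(Set.range d \ {0}) | q x y ≠ 0})
    (fun y => isOpen_ne_fun (((q.flip y).continuous).comp continuous_subtype_val) continuous_const)
  have h2 : ∀ᵐ a ∂μ, ∀ y ∈ S, q (d a) y = 0 := (ae_ball_iff hS).2 fun y _ => h1 y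
  apply Lp.ext
  filter_upwards [h2, Lp.coeFn_zero X 1 μ] with a h3 h4
  rw [h4, Pi.zero_apply]
  by_contra h0
  have h5 : q (d a) ≠ 0 := fun h6 => h0 (hq (h6.trans (map_zero q).symm))
  obtain ⟨y, hy⟩ : ∃ y, q (d a) y ≠ 0 := by
    by_contra! h6
    exact h5 (ContinuousLinearMap.ext h6)
  have h6 : (⟨d a, ⟨a, rfl⟩, h0⟩ : ↥(Set.range d \ {0})) ∈
      ⋃ y ∈ S, {x : ↥(Set.range d \ {0}) | q x y ≠ 0} := by
    rw [hSU]
    exact Set.mem_iUnion.2 ⟨y, hy⟩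
  obtain ⟨z, hz, hz'⟩ := Set.mem_iUnion₂.1 h6
  exact hz' (h3 z hz)

/-! ### The adjoint of `T ⊗ I`, handled through its graph. -/

section Adjoint

open BanachFunctionSpace

variable {𝕜 : Type*} [RCLike 𝕜] {A B : Type*} [MeasurableSpace A] [MeasurableSpace B]
  {μ : Measure A} {ν : Measure B} {F G : BanachFunctionSpace 𝕜 ν} {p : F →L[𝕜] G →L[𝕜] 𝕜}
  {X Y : Type*} [NormedAddCommGroup X] [NormedSpace 𝕜 X] [NormedAddCommGroup Y] [NormedSpace 𝕜 Y]

/-- The relation between `w ∈ F ⊗̃ X` and `d ∈ L¹(A; X)` saying that `d` represents the adjoint of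
`T ⊗ I` at `w`. -/
def adjointGraph (hp : IsKotheDualPair F G p) (T : Lp 𝕜 ∞ μ →L[𝕜] G) (q : X →L[𝕜] Y →L[𝕜] 𝕜) :
    Submodule 𝕜 (F.tensorClosure X × Lp X 1 μ) :=
  ⨅ (e : Lp 𝕜 ∞ μ), ⨅ (y : Y), LinearMap.ker
    ((((pairing hp q).flip (tensor (T e) y)).comp
      ((F.tensorClosure X).subtypeL.comp (ContinuousLinearMap.fst 𝕜 _ _)) -
    ((q.lpPairing μ 1 ∞).flip ((ContinuousLinearMap.toSpanSingleton 𝕜 y).compLp e)).comp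
      (ContinuousLinearMap.snd 𝕜 _ _) : (F.tensorClosure X × Lp X 1 μ) →L[𝕜] 𝕜) :
      (F.tensorClosure X × Lp X 1 μ) →ₗ[𝕜] 𝕜)

theorem mem_adjointGraph {hp : IsKotheDualPair F G p} {T : Lp 𝕜 ∞ μ →L[𝕜] G}
    {q : X →L[𝕜] Y →L[𝕜] 𝕜} {z : F.tensorClosure X × Lp X 1 μ} :
    z ∈ adjointGraph hp T q ↔ ∀ (e : Lp 𝕜 ∞ μ) (y : Y), pairing hp q z.1 (tensor (T e) y) =
      q.lpPairing μ 1 ∞ z.2 ((ContinuousLinearMap.toSpanSingleton 𝕜 y).compLp e) := by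
  simp only [adjointGraph, Submodule.mem_iInf, LinearMap.mem_ker]
  exact forall_congr' fun e => forall_congr' fun y => sub_eq_zero

theorem isClosed_adjointGraph (hp : IsKotheDualPair F G p) (T : Lp 𝕜 ∞ μ →L[𝕜] G)
    (q : X →L[𝕜] Y →L[𝕜] 𝕜) :
    IsClosed (adjointGraph hp T q : Set (F.tensorClosure X × Lp X 1 μ)) := by
  simp only [adjointGraph, Submodule.coe_iInf]
  exact isClosed_iInter fun e => isClosed_iInter fun y => ContinuousLinearMap.isClosed_ker _

/-- The graph is single-valued because elementary tensors separate the points of `L¹(A; X)`. -/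
theorem eq_of_mem_adjointGraph {hp : IsKotheDualPair F G p} {T : Lp 𝕜 ∞ μ →L[𝕜] G}
    {q : X →L[𝕜] Y →L[𝕜] 𝕜} (hq : Function.Injective q) {w : F.tensorClosure X}
    {d d' : Lp X 1 μ} (h : (w, d) ∈ adjointGraph hp T q) (h' : (w, d') ∈ adjointGraph hp T q) :
    d = d' := by
  rw [← sub_eq_zero]
  refine Lp.eq_zero_of_lpPairing_eq_zero hq _ fun e y => ?_
  rw [map_sub, sub_apply, ← mem_adjointGraph.1 h e y,
    ← mem_adjointGraph.1 h' e y, sub_self]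

/-- The graph has full domain: weak continuity of the extension makes `⟨w, T_Y ·⟩` a weakly
continuous functional, hence an element of `L¹(A; X)`. -/
theorem exists_mem_adjointGraph (hp : IsKotheDualPair F G p) {T : Lp 𝕜 ∞ μ →L[𝕜] G}
    {q : X →L[𝕜] Y →L[𝕜] 𝕜} (hT : HasWeakStarExtension F T q) (w : F.tensorClosure X) :
    ∃ d, (w, d) ∈ adjointGraph hp T q := by
  obtain ⟨TY, hTY, hcont⟩ := hT
  have hP : (fun (e : Lp Y ∞ μ) (d : Lp X 1 μ) => ∫ a, q (d a) (e a) ∂μ) =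
      fun e d => (q.lpPairing μ 1 ∞).flip.toLinearMap₁₂ e d := by
    funext e d
    exact (q.lpPairing_eq_integral d e).symm
  rw [hP] at hcont
  obtain ⟨d, hd⟩ := exists_eq_of_continuous_weakTopology _ _ hcont w
    ((pairing hp q w).comp TY : Lp Y ∞ μ →ₗ[𝕜] 𝕜) (fun v => rfl)
  refine ⟨d, mem_adjointGraph.2 fun e y => ?_⟩
  rw [← hTY]
  exact hd _

/-- The closed graph theorem in open mapping form: the first projection from the closed, hence
complete, graph onto `F ⊗̃ X` is surjective, so preimages can be chosen with controlled norm. -/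
theorem exists_mem_adjointGraph_norm_le [CompleteSpace X] (hp : IsKotheDualPair F G p)
    {T : Lp 𝕜 ∞ μ →L[𝕜] G} {q : X →L[𝕜] Y →L[𝕜] 𝕜} (hT : HasWeakStarExtension F T q) :
    ∃ C > 0, ∀ w : F.tensorClosure X, ∃ d, (w, d) ∈ adjointGraph hp T q ∧ ‖d‖ ≤ C * ‖w‖ := by
  have : CompleteSpace (adjointGraph hp T q) :=
    (isClosed_adjointGraph hp T q).completeSpace_coe
  let π : adjointGraph hp T q →L[𝕜] F.tensorClosure X :=
    (ContinuousLinearMap.fst 𝕜 (F.tensorClosure X) (Lp X 1 μ)).comp (adjointGraph hp T q).subtypeL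
  have hπ : Function.Surjective π := fun w => by
    obtain ⟨d, hd⟩ := exists_mem_adjointGraph hp hT w
    exact ⟨⟨(w, d), hd⟩, rfl⟩
  obtain ⟨C, hC, h⟩ := ContinuousLinearMap.exists_preimage_norm_le (σ := RingHom.id 𝕜)
    (σ' := RingHom.id 𝕜) (E := adjointGraph hp T q) (F := F.tensorClosure X) π hπ
  refine ⟨C, hC, fun w => ?_⟩
  obtain ⟨⟨⟨w', d⟩, hz⟩, rfl, hz'⟩ := h w
  exact ⟨d, hz, (norm_snd_le (w', d)).trans hz'⟩

theorem exists_lpPairing_eq {T : Lp 𝕜 ∞ μ →L[𝕜] G}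
    (hT : IsWeakStarContinuous p T) (f : F) :
    ∃ d : Lp 𝕜 1 μ, ∀ e : Lp 𝕜 ∞ μ, p f (T e) = ∫ a, d a * e a ∂μ := by
  have hP : (fun (e : Lp 𝕜 ∞ μ) (d : Lp 𝕜 1 μ) => ∫ a, d a * e a ∂μ) =
      fun e d => ((ContinuousLinearMap.mul 𝕜 𝕜).lpPairing μ 1 ∞).flip.toLinearMap₁₂ e d := by
    funext e d
    exact ((ContinuousLinearMap.mul 𝕜 𝕜).lpPairing_eq_integral d e).symm
  unfold IsWeakStarContinuous at hT
  rw [hP] at hT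
  obtain ⟨d, hd⟩ := exists_eq_of_continuous_weakTopology _ _ hT f
    ((p f).comp T : Lp 𝕜 ∞ μ →ₗ[𝕜] 𝕜) (fun v => rfl)
  refine ⟨d, fun e => (hd e).trans ?_⟩
  exact (congrFun (congrFun hP e) d).symm

/-- On elementary tensors the adjoint acts in the scalar factor only, sending `f ⊗ x` to `d ⊗ x`,
where `d` is the image of `f` under the adjoint of `T`. -/
theorem tensor_mem_adjointGraph (hp : IsKotheDualPair F G p) {T : Lp 𝕜 ∞ μ →L[𝕜] G}
    (q : X →L[𝕜] Y →L[𝕜] 𝕜) {f : F} {d : Lp 𝕜 1 μ}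
    (hd : ∀ e : Lp 𝕜 ∞ μ, p f (T e) = ∫ a, d a * e a ∂μ) (x : X) :
    ((⟨tensor f x, tensor_mem_tensorClosure f x⟩ : F.tensorClosure X),
      (ContinuousLinearMap.toSpanSingleton 𝕜 x).compLp d) ∈ adjointGraph hp T q := by
  refine mem_adjointGraph.2 fun e y => ?_
  rw [pairing_tensor_tensor, hd, ContinuousLinearMap.lpPairing_eq_integral, ← integral_mul_const]
  refine integral_congr_ae ?_
  filter_upwards [(ContinuousLinearMap.toSpanSingleton 𝕜 x).coeFn_compLp d,
    (ContinuousLinearMap.toSpanSingleton 𝕜 y).coeFn_compLp e] with a h1 h2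
  simp only [h1, h2, ContinuousLinearMap.toSpanSingleton_apply, map_smul, smul_apply, smul_eq_mul]
  ring

end Adjoint

theorem Linfty.ae_norm_le {𝕜 : Type*} [RCLike 𝕜] {A : Type*} [MeasurableSpace A] {μ : Measure A}
    (e : Lp 𝕜 ∞ μ) : ∀ᵐ a ∂μ, ‖e a‖ ≤ ‖e‖ := by
  filter_upwards [ae_le_eLpNormEssSup (f := e) (μ := μ)] with a ha
  rw [Lp.norm_def, ← toReal_enorm]
  exact ENNReal.toReal_mono (Lp.eLpNorm_ne_top e) (by rwa [eLpNorm_exponent_top])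

/-! ### The bound for `∑ |T eᵢ|` in `F*`. -/

section Bound

open BanachFunctionSpace

variable {𝕜 : Type*} [RCLike 𝕜] {A B : Type*} [MeasurableSpace A] [MeasurableSpace B]
  {μ : Measure A} {ν : Measure B} {F G : BanachFunctionSpace 𝕜 ν} {p : F →L[𝕜] G →L[𝕜] 𝕜}
  {Y : Type*} [NormedAddCommGroup Y] [NormedSpace 𝕜 Y]

/-- With `φ v = 1_{U = v} f` and `d v` its adjoint image, the left side is `∑ᵢ ∑ᵥ vᵢ ∫ d v · eᵢ`. As
`|vᵢ| ≤ 1`, it is controlled by `∫ (∑ᵥ |d v|) (∑ᵢ eᵢ)`, and `∑ᵥ |d v|` is the pointwise norm of the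
adjoint image of `∑ᵥ φ v ⊗ δ_{k v}`. The number of values of `U` does not enter. -/
theorem norm_sum_integral_simpleFunc_mul_le (hp : IsKotheDualPair F G p) {T : Lp 𝕜 ∞ μ →L[𝕜] G}
    (hT : IsWeakStarContinuous p T) {q : lp (fun _ : ℕ => 𝕜) 1 →L[𝕜] Y →L[𝕜] 𝕜}
    (hq : Function.Injective q) {C : ℝ} (hC0 : 0 ≤ C)
    (hC : ∀ w : F.tensorClosure (lp (fun _ : ℕ => 𝕜) 1), ∃ d,
      (w, d) ∈ adjointGraph hp T q ∧ ‖d‖ ≤ C * ‖w‖)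
    {n : ℕ} (e : Fin n → Lp 𝕜 ∞ μ) (he : ∀ i, 0 ≤ (e i : A →ₘ[μ] 𝕜)) (f : F)
    (U : SimpleFunc B (Fin n → 𝕜)) (hU : ∀ b, ‖U b‖ ≤ 1) :
    ‖∑ i, ∫ b, (f : B →ₘ[ν] 𝕜) b * U b i * (T (e i) : B →ₘ[ν] 𝕜) b ∂ν‖ ≤
      C * ‖f‖ * ‖∑ i, e i‖ := by
  classical
  obtain ⟨k, hk⟩ : ∃ k : U.range → ℕ, Function.Injective k :=
    ⟨_, Fin.val_injective.comp (Fintype.equivFin U.range).injective⟩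
  have hφ' : ∀ v : U.range, ∃ φ : F, ∀ᵐ b ∂ν, (φ : B →ₘ[ν] 𝕜) b =
      Set.indicator (U ⁻¹' {v.1}) (f : B →ₘ[ν] 𝕜) b := fun v =>
    ⟨_, coeFn_ofLE _ ((AEEqFun.aestronglyMeasurable _).indicator (U.measurableSet_fiber v.1)) f
      (ae_of_all _ fun b => norm_indicator_le_norm_self _ _)⟩
  choose φ hφ using hφ'
  have hφc := ae_all_iff.2 hφ
  choose d hd using fun v => exists_lpPairing_eq hT (φ v)
  obtain ⟨z, hz⟩ : ∃ z : F.tensorClosure (lp (fun _ : ℕ => 𝕜) 1) ×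
      Lp (lp (fun _ : ℕ => 𝕜) 1) 1 μ, z = ∑ v, ((⟨tensor (φ v) (lp.single 1 (k v) 1), tensor_mem_tensorClosure _ _⟩ :
        F.tensorClosure (lp (fun _ : ℕ => 𝕜) 1)),
      (ContinuousLinearMap.toSpanSingleton 𝕜
        (lp.single 1 (k v) 1 : lp (fun _ : ℕ => 𝕜) 1)).compLp (d v)) := ⟨_, rfl⟩
  have hzmem : z ∈ adjointGraph hp T q := by
    rw [hz]
    exact Submodule.sum_mem _ fun v _ => tensor_mem_adjointGraph hp q (hd v) _
  have hz1 : (z.1 : F.bochner (lp (fun _ : ℕ => 𝕜) 1)) =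
      ∑ v, tensor (φ v) (lp.single 1 (k v) 1 : lp (fun _ : ℕ => 𝕜) 1) := by
    rw [hz, Prod.fst_sum, Submodule.coe_sum]
  have hz2 : z.2 = ∑ v, (ContinuousLinearMap.toSpanSingleton 𝕜
      (lp.single 1 (k v) 1 : lp (fun _ : ℕ => 𝕜) 1)).compLp (d v) := by
    rw [hz, Prod.snd_sum]
  -- The pieces `φ v` live on disjoint level sets, so at each point a single term of the `ℓ¹` sum
  -- survives.
  have hz1n : ‖z.1‖ ≤ ‖f‖ := by
    change ‖(z.1 : F.bochner (lp (fun _ : ℕ => 𝕜) 1))‖ ≤ ‖f‖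
    rw [hz1]
    refine bochner_norm_le_of_ae_le ?_
    filter_upwards [norm_coeFn_sum_tensor_single hk φ, hφc] with b h1 h2
    rw [h1, Finset.sum_eq_single ⟨U b, U.mem_range_self b⟩]
    · rw [h2]
      exact norm_indicator_le_norm_self _ _
    · intro v _ hv
      rw [h2, Set.indicator_of_notMem, norm_zero]
      intro hb
      exact hv (Subtype.ext (Eq.symm hb))
    · simp
  have hz2n : ‖z.2‖ ≤ C * ‖f‖ := by
    -- By uniqueness in the graph, the explicit `z.2` is the representative with controlled norm.
    obtain ⟨d', hd', hn⟩ := hC z.1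
    rw [eq_of_mem_adjointGraph hq (show (z.1, z.2) ∈ _ from hzmem) hd']
    exact hn.trans (mul_le_mul_of_nonneg_left hz1n hC0)
  have hint : ∀ (d : Lp 𝕜 1 μ) (e : Lp 𝕜 ∞ μ), Integrable (fun a => d a * e a) μ := fun d e =>
    (Lp.memLp d).integrable_mul (Lp.memLp e)
  have h1 : ∀ i, ∫ b, (f : B →ₘ[ν] 𝕜) b * U b i * (T (e i) : B →ₘ[ν] 𝕜) b ∂ν =
      ∑ v : U.range, v.1 i * ∫ a, d v a * e i a ∂μ := by
    intro i
    have h2 : ∀ v : U.range, v.1 i * ∫ a, d v a * e i a ∂μ =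
        ∫ b, v.1 i * ((φ v : B →ₘ[ν] 𝕜) b * (T (e i) : B →ₘ[ν] 𝕜) b) ∂ν := fun v => by
      rw [integral_const_mul, ← hd v, (hp.2 _ _).2]
    simp_rw [h2]
    rw [← integral_finsetSum _ fun v _ => ((hp.2 (φ v) (T (e i))).1.const_mul (v.1 i))]
    refine integral_congr_ae ?_
    filter_upwards [hφc] with b hb
    rw [Finset.sum_eq_single ⟨U b, U.mem_range_self b⟩]
    · rw [hb, Set.indicator_of_mem (by simp)]
      ring
    · intro v _ hv
      rw [hb, Set.indicator_of_notMem, zero_mul, mul_zero]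
      intro hb
      exact hv (Subtype.ext (Eq.symm hb))
    · simp
  have hv1 : ∀ (v : U.range) (i : Fin n), ‖v.1 i‖ ≤ 1 := by
    intro v i
    obtain ⟨b, hb⟩ := SimpleFunc.mem_range.1 v.2
    rw [← hb]
    exact (norm_le_pi_norm _ _).trans (hU b)
  calc ‖∑ i, ∫ b, (f : B →ₘ[ν] 𝕜) b * U b i * (T (e i) : B →ₘ[ν] 𝕜) b ∂ν‖
      = ‖∑ i, ∑ v : U.range, v.1 i * ∫ a, d v a * e i a ∂μ‖ := by simp_rw [h1]
    _ ≤ ∑ i, ∑ v : U.range, ∫ a, ‖d v a * e i a‖ ∂μ := by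
        refine (norm_sum_le _ _).trans (Finset.sum_le_sum fun i _ => ?_)
        refine (norm_sum_le _ _).trans (Finset.sum_le_sum fun v _ => ?_)
        rw [norm_mul]
        exact (mul_le_of_le_one_left (norm_nonneg _) (hv1 v i)).trans
          (norm_integral_le_integral_norm _)
    _ = ∫ a, ∑ i, ∑ v : U.range, ‖d v a * e i a‖ ∂μ := by
        rw [integral_finsetSum _ fun i _ => integrable_finsetSum _ fun v _ => (hint _ _).norm]
        refine Finset.sum_congr rfl fun i _ => ?_
        rw [integral_finsetSum _ fun v _ => (hint _ _).norm]
    _ ≤ ∫ a, ‖z.2 a‖ * ‖∑ i, e i‖ ∂μ := by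
        refine integral_mono_ae
          (integrable_finsetSum _ fun i _ => integrable_finsetSum _ fun v _ => (hint _ _).norm)
          ((L1.integrable_coeFn z.2).norm.mul_const _) ?_
        have h2 := Lp.norm_coeFn_sum_single hk d
        rw [← hz2] at h2
        filter_upwards [h2, Linfty.ae_norm_le (∑ i, e i), Lp.coeFn_finsetSum Finset.univ e,
          ae_all_iff.2 fun i => Linfty.nonneg_iff_ae.1 (he i)] with a h3 h4 h5 h6
        have h7 : ∑ i, ‖e i a‖ ≤ ‖∑ i, e i‖ := by
          refine le_trans ?_ h4
          have h8 : ∑ i, e i a = ((∑ i, ‖e i a‖ : ℝ) : 𝕜) := by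
            rw [RCLike.ofReal_sum]
            exact Finset.sum_congr rfl fun i _ => (RCLike.norm_of_nonneg' (h6 i)).symm
          rw [h5, Finset.sum_apply, h8, RCLike.norm_ofReal]
          exact le_abs_self _
        simp only [norm_mul, ← Finset.sum_mul]
        rw [← Finset.mul_sum, ← h3]
        exact mul_le_mul_of_nonneg_left h7 (norm_nonneg _)
    _ = ‖z.2‖ * ‖∑ i, e i‖ := by
        rw [integral_mul_const, L1.norm_eq_integral_norm]
    _ ≤ C * ‖f‖ * ‖∑ i, e i‖ := mul_le_mul_of_nonneg_right hz2n (norm_nonneg _)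

theorem norm_pairing_sum_modulus_le (hp : IsKotheDualPair F G p) {T : Lp 𝕜 ∞ μ →L[𝕜] G}
    (hT : IsWeakStarContinuous p T) {q : lp (fun _ : ℕ => 𝕜) 1 →L[𝕜] Y →L[𝕜] 𝕜}
    (hq : Function.Injective q) {C : ℝ} (hC0 : 0 ≤ C)
    (hC : ∀ w : F.tensorClosure (lp (fun _ : ℕ => 𝕜) 1), ∃ d,
      (w, d) ∈ adjointGraph hp T q ∧ ‖d‖ ≤ C * ‖w‖)
    {n : ℕ} (e : Fin n → Lp 𝕜 ∞ μ) (he : ∀ i, 0 ≤ (e i : A →ₘ[μ] 𝕜)) (f : F) :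
    ‖p f (∑ i, modulus (T (e i)))‖ ≤ C * ‖f‖ * ‖∑ i, e i‖ := by
  -- All phases are packed into one vector-valued function, so that a simple approximation
  -- partitions `B` for all `i` at once. Where `T (e i)` vanishes the phase is `0 / 0 = 0`, which
  -- keeps `‖U b‖ ≤ 1` and `Uᵢ T eᵢ = |T eᵢ|` at every point.
  obtain ⟨U, hU'⟩ : ∃ U : B → Fin n → 𝕜, U = fun b i =>
    (starRingEnd 𝕜) ((T (e i) : B →ₘ[ν] 𝕜) b) / ((‖(T (e i) : B →ₘ[ν] 𝕜) b‖ : ℝ) : 𝕜) := ⟨_, rfl⟩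
  have hU : StronglyMeasurable U := by
    rw [hU']
    refine (measurable_pi_iff.2 fun i => ?_).stronglyMeasurable
    have h := (AEEqFun.stronglyMeasurable (T (e i) : B →ₘ[ν] 𝕜)).measurable
    exact (RCLike.continuous_conj.measurable.comp h).div
      (RCLike.continuous_ofReal.measurable.comp h.norm)
  have hU1 : ∀ b, ‖U b‖ ≤ 1 := fun b => by
    refine (pi_norm_le_iff_of_nonneg zero_le_one).2 fun i => ?_
    rw [hU', norm_div, RCLike.norm_ofReal, abs_norm, RCLike.norm_conj]
    exact div_self_le_one _
  have hUT : ∀ b i, U b i * (T (e i) : B →ₘ[ν] 𝕜) b =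
      ((‖(T (e i) : B →ₘ[ν] 𝕜) b‖ : ℝ) : 𝕜) := by
    intro b i
    by_cases h : ((‖(T (e i) : B →ₘ[ν] 𝕜) b‖ : ℝ) : 𝕜) = 0
    · have h0 : (T (e i) : B →ₘ[ν] 𝕜) b = 0 := by simpa using h
      simp [h0]
    · rw [hU', div_mul_eq_mul_div, RCLike.conj_mul, sq, mul_div_cancel_right₀ _ h]
  have h1 : p f (∑ i, modulus (T (e i))) =
      ∑ i, ∫ b, (f : B →ₘ[ν] 𝕜) b * U b i * (T (e i) : B →ₘ[ν] 𝕜) b ∂ν := by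
    rw [map_sum]
    refine Finset.sum_congr rfl fun i _ => ?_
    rw [(hp.2 _ _).2]
    refine integral_congr_ae ?_
    filter_upwards [coeFn_modulus (T (e i))] with b hb
    rw [hb, mul_assoc, hUT]
  rw [h1]
  -- Simple approximations bounded by `1` converge pointwise to `U`, and `|f T eᵢ|` is an integrable
  -- majorant, so the estimate for simple functions passes to the limit.
  have hlim : Tendsto (fun m => ∑ i, ∫ b, (f : B →ₘ[ν] 𝕜) b * hU.approxBounded 1 m b i *
      (T (e i) : B →ₘ[ν] 𝕜) b ∂ν) atTop
      (𝓝 (∑ i, ∫ b, (f : B →ₘ[ν] 𝕜) b * U b i * (T (e i) : B →ₘ[ν] 𝕜) b ∂ν)) := by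
    refine tendsto_finsetSum _ fun i _ => ?_
    refine tendsto_integral_of_dominated_convergence
      (fun b => ‖(f : B →ₘ[ν] 𝕜) b * (T (e i) : B →ₘ[ν] 𝕜) b‖) (fun m => ?_)
      (hp.2 f (T (e i))).1.norm (fun m => ae_of_all _ fun b => ?_) (ae_of_all _ fun b => ?_)
    · refine ((AEEqFun.aestronglyMeasurable _).mul ?_).mul (AEEqFun.aestronglyMeasurable _)
      exact ((continuous_apply i).comp_stronglyMeasurable
        (hU.approxBounded 1 m).stronglyMeasurable).aestronglyMeasurable
    · rw [norm_mul, norm_mul, norm_mul]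
      refine mul_le_mul_of_nonneg_right (mul_le_of_le_one_right (norm_nonneg _) ?_) (norm_nonneg _)
      exact (norm_le_pi_norm _ _).trans (hU.norm_approxBounded_le zero_le_one m b)
    · exact (((tendsto_pi_nhds.1 (hU.tendsto_approxBounded_of_norm_le (hU1 b))) i).const_mul
        _).mul_const _
  exact le_of_tendsto hlim.norm (Eventually.of_forall fun m =>
    norm_sum_integral_simpleFunc_mul_le hp hT hq hC0 hC e he f _
      (hU.norm_approxBounded_le zero_le_one m))

end Bound

/-! ### Positivity in `G` tested against `F`. -/

section Positivity

open BanachFunctionSpace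

variable {𝕜 : Type*} [RCLike 𝕜] {B : Type*} [MeasurableSpace B] {ν : Measure B}
  {F G : BanachFunctionSpace 𝕜 ν} {p : F →L[𝕜] G →L[𝕜] 𝕜}

/-- By the ideal property `1_s f` is again a positive element of `F`, so the integral of `f g` over
every measurable set `s` is nonnegative; this determines the signs of the real and imaginary parts.
-/
theorem IsKotheDualPair.ae_mul_nonneg (hp : IsKotheDualPair F G p) {g : G}
    (hg : ∀ f : F, 0 ≤ f → 0 ≤ p f g) {f : F} (hf : 0 ≤ f) :
    ∀ᵐ b ∂ν, 0 ≤ (f : B →ₘ[ν] 𝕜) b * (g : B →ₘ[ν] 𝕜) b := by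
  have hi := (hp.2 f g).1
  have key : ∀ s, MeasurableSet s →
      0 ≤ ∫ b in s, (f : B →ₘ[ν] 𝕜) b * (g : B →ₘ[ν] 𝕜) b ∂ν := by
    intro s hs
    set fs : F := ofLE (Set.indicator s (f : B →ₘ[ν] 𝕜))
      ((AEEqFun.aestronglyMeasurable _).indicator hs) f
      (ae_of_all _ fun b => norm_indicator_le_norm_self _ _) with hfs
    have hfc : ∀ᵐ b ∂ν, (fs : B →ₘ[ν] 𝕜) b = Set.indicator s (f : B →ₘ[ν] 𝕜) b :=
      coeFn_ofLE _ _ _ _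
    have h1 : 0 ≤ fs := by
      rw [nonneg_iff_ae] at hf ⊢
      filter_upwards [hf, hfc] with b h1 h2
      rw [h2]
      by_cases hb : b ∈ s <;> simp [hb, h1]
    have h2 := hg fs h1
    rw [(hp.2 fs g).2] at h2
    rw [← integral_indicator hs]
    convert h2 using 1
    refine integral_congr_ae ?_
    filter_upwards [hfc] with b hb
    rw [hb]
    by_cases hb : b ∈ s <;> simp [hb]
  have hre := ae_nonneg_of_forall_setIntegral_nonneg hi.re fun s hs _ => by
    rw [integral_re hi.integrableOn]
    exact (RCLike.nonneg_iff.1 (key s hs)).1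
  have him := hi.im.ae_eq_zero_of_forall_setIntegral_eq_zero fun s hs _ => by
    rw [integral_im hi.integrableOn]
    exact (RCLike.nonneg_iff.1 (key s hs)).2
  filter_upwards [hre, him] with b h1 h2
  exact RCLike.nonneg_iff.2 ⟨h1, h2⟩

/-- In a Köthe dual pair, positivity is tested against the positive elements of the partner. -/
theorem IsKotheDualPair.nonneg_of_forall_pairing_nonneg (hp : IsKotheDualPair F G p) {g : G}
    (hg : ∀ f : F, 0 ≤ f → 0 ≤ p f g) : 0 ≤ g := by
  set N : Set B := {b | ¬ 0 ≤ (g : B →ₘ[ν] 𝕜) b} with hN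
  have hNm : MeasurableSet N := by
    have hm := (AEEqFun.stronglyMeasurable (g : B →ₘ[ν] 𝕜)).measurable
    have h1 : N = ({b | 0 ≤ RCLike.re ((g : B →ₘ[ν] 𝕜) b)} ∩
        {b | RCLike.im ((g : B →ₘ[ν] 𝕜) b) = 0})ᶜ := by
      ext b
      exact not_congr RCLike.nonneg_iff
    rw [h1]
    exact ((measurableSet_le measurable_const (RCLike.continuous_re.measurable.comp hm)).inter
      (measurableSet_eq_fun (RCLike.continuous_im.measurable.comp hm) measurable_const)).compl
  -- `g'` is `g` cut down to the set where positivity fails. There `|f| g ≥ 0` forces `f = 0` a.e.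
  -- for each `f ∈ F`, so `g'` is annihilated by `F` and vanishes by separation.
  set g' : G := ofLE (Set.indicator N (g : B →ₘ[ν] 𝕜))
    ((AEEqFun.aestronglyMeasurable _).indicator hNm) g
    (ae_of_all _ fun b => norm_indicator_le_norm_self _ _) with hg'
  have hgc : ∀ᵐ b ∂ν, (g' : B →ₘ[ν] 𝕜) b = Set.indicator N (g : B →ₘ[ν] 𝕜) b :=
    coeFn_ofLE _ _ _ _
  have h0 : g' = 0 := by
    refine hp.1.2 (ContinuousLinearMap.ext fun f => ?_)
    rw [map_zero, ContinuousLinearMap.flip_apply, (hp.2 f g').2, zero_apply]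
    refine integral_eq_zero_of_ae ?_
    filter_upwards [hgc, hp.ae_mul_nonneg hg (modulus_nonneg f), coeFn_modulus f] with b h1 h2 h3
    rw [Pi.zero_apply, h1]
    by_cases hb : b ∈ N
    · rw [h3] at h2
      have hf0 : (f : B →ₘ[ν] 𝕜) b = 0 := by
        by_contra hne
        have h4 : 0 < ((‖(f : B →ₘ[ν] 𝕜) b‖ : ℝ) : 𝕜) :=
          RCLike.ofReal_pos.2 (norm_pos_iff.2 hne)
        exact hb (le_of_mul_le_mul_left (by rwa [mul_zero]) h4)
      rw [hf0, zero_mul]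
    · rw [Set.indicator_of_notMem hb, mul_zero]
  rw [nonneg_iff_ae]
  rw [h0] at hgc
  filter_upwards [hgc, coeFn_zero (E := G)] with b h1 h2
  by_contra hb
  rw [h2, Set.indicator_of_mem (show b ∈ N from hb)] at h1
  exact hb h1.le

end Positivity

/-! ### Case (ii): bands in `F*`. -/

section Band

open BanachFunctionSpace

variable {𝕜 : Type*} [RCLike 𝕜] {A B : Type*} [MeasurableSpace A] [MeasurableSpace B]
  {μ : Measure A} {ν : Measure B} {F G : BanachFunctionSpace 𝕜 ν} {p : F →L[𝕜] G →L[𝕜] 𝕜}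

theorem IsKotheDualPair.pairing_le_pairing (hp : IsKotheDualPair F G p) {f : F} (hf : 0 ≤ f)
    {g h : G} (hgh : g ≤ h) : p f g ≤ p f h := by
  rw [← sub_nonneg, ← map_sub, (hp.2 f (h - g)).2, RCLike.nonneg_iff,
    ← integral_re (hp.2 f (h - g)).1, ← integral_im (hp.2 f (h - g)).1]
  have h0 : ∀ᵐ b ∂ν, 0 ≤ (f : B →ₘ[ν] 𝕜) b * ((h - g : G) : B →ₘ[ν] 𝕜) b := by
    filter_upwards [nonneg_iff_ae.1 hf, nonneg_iff_ae.1 (sub_nonneg.2 hgh)] with b h1 h2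
    exact mul_nonneg h1 h2
  constructor
  · refine integral_nonneg_of_ae ?_
    filter_upwards [h0] with b hb using (RCLike.nonneg_iff.1 hb).1
  · refine integral_eq_zero_of_ae ?_
    filter_upwards [h0] with b hb using (RCLike.nonneg_iff.1 hb).2

/-- An upward directed set in `G` that is bounded in `F*` has a supremum if `G` is a band
in `F*`. -/
theorem exists_isLUB_of_isDualBand (hp : IsKotheDualPair F G p)
    (hW : IsDualBand (LinearMap.range (p.flip : G →ₗ[𝕜] F →L[𝕜] 𝕜))) {D : Set G}
    (hne : D.Nonempty) (hdir : DirectedOn (· ≤ ·) D) {R : ℝ}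
    (hR : ∀ d ∈ D, ‖p.flip d‖ ≤ R) : ∃ s, IsLUB D s := by
  have : Nonempty D := hne.to_subtype
  have : IsDirectedOrder D := hdir.isDirectedOrder
  -- By Banach–Alaoglu, an ultrafilter finer than the order filter of `D` converges weak*. Each `d`
  -- is eventually exceeded along it, so the limit is an upper bound; inequalities pass to limits,
  -- so it is the least one in `F*`.
  obtain ⟨φ, -, hφ⟩ := (WeakDual.isCompact_closedBall (𝕜 := 𝕜) (E := F) 0 R).ultrafilter_le_nhds
    ((Ultrafilter.of (atTop : Filter D)).map
      fun d : D => StrongDual.toWeakDual (p.flip (d : G))) (by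
      rw [le_principal_iff]
      refine Filter.mem_map.2 (Filter.univ_mem' fun d => ?_)
      simpa using! hR d d.2)
  have hlim : ∀ f : F, Tendsto (fun d : D => p f d) (Ultrafilter.of (atTop : Filter D))
      (𝓝 (φ f)) := fun f =>
    ((WeakDual.eval_continuous (𝕜 := 𝕜) f).tendsto φ).comp hφ
  set ψ : F →L[𝕜] 𝕜 := WeakDual.toStrongDual φ with hψ
  have hub : ∀ d ∈ D, dualLE (p.flip d) ψ := fun d hd f hf =>
    ge_of_tendsto (hlim f) (Ultrafilter.of_le _ ((eventually_ge_atTop (⟨d, hd⟩ : D)).mono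
      fun d' hd' => hp.pairing_le_pairing hf hd'))
  have hleast : ∀ t : F →L[𝕜] 𝕜, (∀ d ∈ D, dualLE (p.flip d) t) → dualLE ψ t :=
    fun t ht f hf => le_of_tendsto (hlim f) (Eventually.of_forall fun d => ht d d.2 f hf)
  obtain ⟨s, hs⟩ := hW.2 (p.flip '' D) (by rintro _ ⟨d, -, rfl⟩; exact ⟨d, rfl⟩) ψ
    (by rintro _ ⟨d, hd, rfl⟩; exact hub d hd)
    (fun t ht => hleast t fun d hd => ht _ ⟨d, hd, rfl⟩)
  have hs : p.flip s = ψ := hs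
  rw [← hs] at hub hleast
  -- The embedding of `G` into `F*` reflects the order, which brings the supremum in `F*` back to
  -- one in `G`.
  have hle : ∀ g h : G, dualLE (p.flip g) (p.flip h) → g ≤ h := fun g h hgh =>
    sub_nonneg.1 (hp.nonneg_of_forall_pairing_nonneg fun f hf => by
      rw [map_sub]
      exact sub_nonneg.2 (hgh f hf))
  exact ⟨s, fun d hd => hle _ _ (hub d hd), fun t ht => hle _ _ (hleast _ fun d hd f hf =>
    hp.pairing_le_pairing hf (ht hd))⟩

/-- A weak* continuous operator `L∞(A) → G` with a weak* continuous extension along `⟨ℓ¹, Y⟩` is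
regular if `G` is a band in `F*`. -/
theorem IsDualBand.isRegularOperator (hp : IsKotheDualPair F G p) {T : Lp 𝕜 ∞ μ →L[𝕜] G}
    (hT : IsWeakStarContinuous p T)
    (hW : IsDualBand (LinearMap.range (p.flip : G →ₗ[𝕜] F →L[𝕜] 𝕜)))
    {Y : Type*} [NormedAddCommGroup Y] [NormedSpace 𝕜 Y]
    {q : lp (fun _ : ℕ => 𝕜) 1 →L[𝕜] Y →L[𝕜] 𝕜} (hq : Function.Injective q)
    (hTY : HasWeakStarExtension F T q) : IsRegularOperator (T : Lp 𝕜 ∞ μ →ₗ[𝕜] G) := by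
  obtain ⟨C, hC0, hC⟩ := exists_mem_adjointGraph_norm_le hp hTY
  refine isRegularOperator_of_isLUB_variationSet _ fun e he =>
    exists_isLUB_of_isDualBand hp hW ⟨_, modulus_mem_variationSet _ he⟩
      (directedOn_variationSet _ e) (R := C * ‖e‖) ?_
  rintro _ ⟨n, f, hf, rfl, rfl⟩
  refine ContinuousLinearMap.opNorm_le_bound _ (by positivity) fun x => ?_
  rw [mul_right_comm]
  exact norm_pairing_sum_modulus_le hp hT hq hC0.le hC f hf x

end Band

end

theorem mainTheorem8 {𝕜 : Type*} [RCLike 𝕜] {A B : Type*} [MeasurableSpace A] [MeasurableSpace B]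
    (μ : Measure A) (hμ : IsSemifinite μ) (ν : Measure B)
    (F G : BanachFunctionSpace 𝕜 ν) (p : F →L[𝕜] G →L[𝕜] 𝕜) (hp : IsKotheDualPair F G p)
    (T : Lp 𝕜 ∞ μ →L[𝕜] G) (hT : IsWeakStarContinuous p T) :
    (G.HasLeviNorm →
      ∀ (X : Type*) [NormedAddCommGroup X] [NormedSpace 𝕜 X] [CompleteSpace X]
        (q : X →L[𝕜] lp (fun _ : ℕ => 𝕜) 1 →L[𝕜] 𝕜),
        IsBanachDualPair q → HasWeakStarExtension F T q →
          IsRegularOperator (T : Lp 𝕜 ∞ μ →ₗ[𝕜] G)) ∧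
    (IsDualBand (LinearMap.range (p.flip : G →ₗ[𝕜] F →L[𝕜] 𝕜)) →
      ∀ (Y : Type*) [NormedAddCommGroup Y] [NormedSpace 𝕜 Y] [CompleteSpace Y]
        (q : lp (fun _ : ℕ => 𝕜) 1 →L[𝕜] Y →L[𝕜] 𝕜),
        IsBanachDualPair q → HasWeakStarExtension F T q →
          IsRegularOperator (T : Lp 𝕜 ∞ μ →ₗ[𝕜] G)) := by
  refine ⟨fun hG X _ _ _ q _ hTY => ?_, fun hW Y _ _ _ q hq hTY =>
    IsDualBand.isRegularOperator hp hT hW hq.1 hTY⟩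
  obtain ⟨TY, h, -⟩ := hTY
  exact hG.isRegularOperator T TY h
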